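/- Theorem. For every $d\ge 2$, the $(d+1)$-dimensional cross polytope $\mathcal{O}^{d+1}=\mathrm{conv}\{\pm e_1,\dots,\pm e_{d+1}\}$ is Möbius unique: it is edge-scribable, and the ball-arrangement projections $\mathsf{B}(\mathcal{Q})$, $\mathsf{B}(\mathcal{Q}')$ of any two of its edge-scribed realizations $\mathcal{Q},\mathcal{Q}'$ are Möbius equivalent. Here an edge-scribed realization of a $(d+1)$-polytope $\mathcal{P}$ is a full-dimensional convex polytope $\mathcal{Q}\subset\mathbb{R}^{d+1}$ whose face lattice is isomorphic to that of $\mathcal{P}$ and all of whose edges are tangent to the unit sphere $\mathbb{S}^d$ (each edge contains a point of $\mathbb{S}^d$ at which its affine hull is tangent to $\mathbb{S}^d$); $\mathcal{P}$ is edge-scribable if it has such a realization. Its vertices then lie outside $\mathbb{S}^d$. The ball-arrangement projection $\mathsf{B}(\mathcal{Q})$ is the collection of $d$-balls of $\widehat{\mathbb{R}^d}=\mathbb{R}^d\cup\{\infty\}$ obtained by taking, for each vertex $v$ of $\mathcal{Q}$, the closed part of $\mathbb{S}^d$ illuminated by a light source at $v$ (the points $x\in\mathbb{S}^d$ such that the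 segment $[v,x]$ does not meet the open unit ball) and projecting it stereographically from the North Pole. Two collections of $d$-balls are Möbius equivalent if some element of the Möbius group of $\widehat{\mathbb{R}^d}$, i.e. the group generated by inversions in spheres and reflections in hyperplanes, maps one collection onto the other. -/

import Mathlib

open scoped RealInnerProductSpace

noncomputable section

namespace BallPacking

/-- The Euclidean space `𝔼ⁿ`. -/
abbrev E (n : ℕ) : Type := EuclideanSpace ℝ (Fin n)

/-! ### Convex polytopes -/

/-- `P` is an `n`-polytope of `𝔼ⁿ`: the convex hull of finitely many points, of full dimension. -/
def IsPolytope {n : ℕ} (P : Set (E n)) : Prop :=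
  (∃ s : Finset (E n), P = convexHull ℝ (s : Set (E n))) ∧ affineSpan ℝ P = ⊤

/-- The faces of `P`: the empty set and the sets of maximizers on `P` of linear functionals
(the zero functional gives `P` itself). They are ordered by inclusion. -/
abbrev Face {n : ℕ} (P : Set (E n)) : Type := {F : Set (E n) // IsExposed ℝ P F}

/-- Combinatorial equivalence: the face lattices are isomorphic. -/
def CombEquiv {n m : ℕ} (P : Set (E n)) (Q : Set (E m)) : Prop :=
  Nonempty (Face P ≃o Face Q)

/-- The vertices of `P`: the points `v` such that `{v}` is a face. -/
def vertices {n : ℕ} (P : Set (E n)) : Set (E n) :=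
  {v | IsExposed ℝ P {v}}

/-- The edges of `P`: the faces of dimension one. -/
def edges {n : ℕ} (P : Set (E n)) : Set (Set (E n)) :=
  {e | IsExposed ℝ P e ∧ Module.finrank ℝ (vectorSpan ℝ e) = 1}

/-- The unit sphere of `𝔼ⁿ`. -/
def unitSphere (n : ℕ) : EuclideanGeometry.Sphere (E n) := ⟨0, 1⟩

/-- Every edge of `P` is tangent to the unit sphere, the point of tangency lying on the edge. -/
def IsEdgeScribed {n : ℕ} (P : Set (E n)) : Prop :=
  ∀ e ∈ edges P, ∃ p ∈ e, (unitSphere n).IsTangentAt p (affineSpan ℝ e)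

/-- `Q` is an edge-scribed realization of `P`: a polytope combinatorially equivalent to `P` all of
whose edges are tangent to the unit sphere. -/
structure IsEdgeScribedRealization {n : ℕ} (P Q : Set (E n)) : Prop where
  isPolytope : IsPolytope Q
  combEquiv : CombEquiv P Q
  isEdgeScribed : IsEdgeScribed Q

/-- The `n`-dimensional cross polytope (`n`-octahedron), the convex hull of the `± eᵢ`. -/
def crossPolytope (n : ℕ) : Set (E n) :=
  convexHull ℝ {x | ∃ i : Fin n, x = EuclideanSpace.single i 1 ∨ x = -EuclideanSpace.single i 1}

/-! ### The ball-arrangement projection -/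

/-- The extended space `ℝᵈ ∪ {∞}`. -/
abbrev ExtE (d : ℕ) : Type := OnePoint (E d)

/-- The stereographic projection from the North Pole `(0, …, 0, 1)` onto the equatorial hyperplane
(only its values on the unit sphere matter). -/
def stereo (d : ℕ) (x : E (d + 1)) : ExtE d :=
  open Classical in
  if x (Fin.last d) = 1 then OnePoint.infty
  else ((WithLp.toLp 2 fun i : Fin d => x i.castSucc / (1 - x (Fin.last d)) : E d) : ExtE d)

/-- The part of the unit sphere that is illuminated by a light source at `v`: the points `x` of the
sphere such that no point between `v` and `x` is inside the open unit ball. -/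
def illuminated {n : ℕ} (v : E n) : Set (E n) :=
  {x | ‖x‖ = 1 ∧ ∀ y ∈ segment ℝ v x, 1 ≤ ‖y‖}

/-- The `d`-ball of the extended space corresponding to the point `v` outside the unit sphere. -/
def ballOf {d : ℕ} (v : E (d + 1)) : Set (ExtE d) := stereo d '' illuminated v

/-- The ball-arrangement projection of `P`. -/
def ballArrangement {d : ℕ} (P : Set (E (d + 1))) : Set (Set (ExtE d)) :=
  ballOf '' vertices P

/-! ### Möbius transformations -/

/-- The underlying function of the inversion in the sphere of centre `c` and radius `R`. -/
def inversionFun {d : ℕ} (c : E d) (R : ℝ) : ExtE d → ExtE d :=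
  open Classical in
  fun z => z.elim (c : ExtE d) fun x =>
    if x = c then OnePoint.infty else ((EuclideanGeometry.inversion c R x : E d) : ExtE d)

theorem inversionFun_involutive {d : ℕ} (c : E d) {R : ℝ} (hR : 0 < R) :
    Function.Involutive (inversionFun c R) := by
  intro z
  induction z using OnePoint.rec with
  | infty => simp [inversionFun]
  | coe x =>
    by_cases h : x = c
    · simp [inversionFun, h]
    · simp [inversionFun, h, EuclideanGeometry.inversion_eq_center hR.ne',
        EuclideanGeometry.inversion_inversion c hR.ne' x]

/-- The inversion in the sphere of centre `c` and radius `R > 0`, which exchanges `c` and `∞`. -/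
def sphereInversion {d : ℕ} (c : E d) (R : ℝ) (hR : 0 < R) : Equiv.Perm (ExtE d) :=
  (inversionFun_involutive c hR).toPerm

/-- The underlying function of the reflection in the hyperplane `⟪u, x⟫ = a`, `u` a unit vector. -/
def reflectionFun {d : ℕ} (u : E d) (a : ℝ) : ExtE d → ExtE d :=
  OnePoint.map fun x => x - (2 * (⟪u, x⟫ - a)) • u

theorem reflectionFun_involutive {d : ℕ} (u : E d) (a : ℝ) (hu : ‖u‖ = 1) :
    Function.Involutive (reflectionFun u a) := by
  intro z
  induction z using OnePoint.rec with
  | infty => simp [reflectionFun]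
  | coe x =>
    have h : ⟪u, u⟫ = 1 := by rw [real_inner_self_eq_norm_sq, hu]; norm_num
    simp only [reflectionFun, OnePoint.map_some, inner_sub_right, inner_smul_right, h]
    congr 1
    module

/-- The reflection in the hyperplane `⟪u, x⟫ = a`, `u` a unit vector; it fixes `∞`. -/
def hyperplaneReflection {d : ℕ} (u : E d) (a : ℝ) (hu : ‖u‖ = 1) : Equiv.Perm (ExtE d) :=
  (reflectionFun_involutive u a hu).toPerm

/-- The Möbius group of the extended space, generated by the inversions in spheres and the
reflections in hyperplanes. -/
def moebiusGroup (d : ℕ) : Subgroup (Equiv.Perm (ExtE d)) :=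
  Subgroup.closure
    ({f | ∃ (c : E d) (R : ℝ) (hR : 0 < R), f = sphereInversion c R hR} ∪
      {f | ∃ (u : E d) (a : ℝ) (hu : ‖u‖ = 1), f = hyperplaneReflection u a hu})

/-- Two collections of subsets of the extended space are Möbius equivalent if some Möbius
transformation maps one onto the other. -/
def MoebiusEquiv {d : ℕ} (A B : Set (Set (ExtE d))) : Prop :=
  ∃ f ∈ moebiusGroup d, (fun b : Set (ExtE d) => f '' b) '' A = B

/-- `P` is edge-scribable, and the ball-arrangement projections of all its edge-scribed
realizations are Möbius equivalent. -/
def IsMoebiusUnique {d : ℕ} (P : Set (E (d + 1))) : Prop :=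
  (∃ Q, IsEdgeScribedRealization P Q) ∧
    ∀ Q Q', IsEdgeScribedRealization P Q → IsEdgeScribedRealization P Q' →
      MoebiusEquiv (ballArrangement Q) (ballArrangement Q')

end BallPacking

end

/-! Existence: the midpoint of two orthogonal vectors of length `√2` is a unit vector perpendicular
to their difference, so the cross polytope scaled by `√2` is edge-scribed.

Uniqueness takes place in Lorentzian space. A vertex `v` outside the sphere gives the spacelike unit
vector `unitVector v`, proportional to `(v, 1)`, and its ball is the set of points whose light
vectors pair nonnegatively with it (`ballOf_eq_lightBall`). Tangency of the edge `vw` at a point of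
the segment says that the two unit vectors have product `-1` (`inner_of_tangent_segment`). Hence the
combinatorics fixes every Gram entry except those of opposite pairs.

These are forced too (`lorentz_opposite`). Write `z_i` and `y_i` for the sum and the difference of
the `i`-th opposite pair. The `y_i` are non-isotropic, mutually orthogonal and orthogonal to every
`z_j`. There are `d + 1` of them in dimension `d + 2`, so all `z_j` lie on one line. As `⟨z_i, z_j⟩
= -4` for `i ≠ j`, comparison with a third index gives `z_i = z_j`; then `⟨z_i, z_i⟩ = -4`, and
opposite vectors have product `-3`.

Two configurations with the same Gram matrix are matched by a product of reflections, as in Witt's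
theorem (`exists_isMoebiusLinear_frame`). The common timelike vector `z` is moved first, which makes
every later difference spacelike. Each reflection induces an inversion or a hyperplane reflection
(`exists_moebius_lorentzReflection`). -/

open scoped RealInnerProductSpace

noncomputable section

namespace BallPacking

/-! ### Faces and vertices of polytopes, and isomorphisms of face lattices. -/

section Polytopes

variable {n m : ℕ}

theorem isCompact_convexHull_finset (s : Finset (E n)) :
    IsCompact (convexHull ℝ (s : Set (E n))) :=
  s.finite_toSet.isCompact_convexHull ℝ

/-- A face of the convex hull of a finite set is the convex hull of the points of the set that it
contains. -/
theorem face_eq_convexHull_inter {s : Finset (E n)} {F : Set (E n)}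
    (hF : IsExposed ℝ (convexHull ℝ (s : Set (E n))) F) : F = convexHull ℝ ((s : Set (E n)) ∩ F) := by
  have hK := isCompact_convexHull_finset s
  have hconv : Convex ℝ F := hF.convex (convex_convexHull ℝ _)
  refine Set.Subset.antisymm ?_ (convexHull_min Set.inter_subset_right hconv)
  have hext : F.extremePoints ℝ ⊆ (s : Set (E n)) ∩ F := fun x hx =>
    ⟨extremePoints_convexHull_subset (hF.isExtreme.extremePoints_subset_extremePoints hx),
      extremePoints_subset hx⟩
  calc F = closure (convexHull ℝ (F.extremePoints ℝ)) :=
        (closure_convexHull_extremePoints (hF.isCompact hK) hconv).symm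
    _ ⊆ closure (convexHull ℝ ((s : Set (E n)) ∩ F)) := closure_mono (convexHull_mono hext)
    _ = convexHull ℝ ((s : Set (E n)) ∩ F) :=
        ((s.finite_toSet.inter_of_left F).isClosed_convexHull ℝ).closure_eq

theorem toExposed_convexHull {s : Finset (E n)} (l : StrongDual ℝ (E n)) :
    l.toExposed (convexHull ℝ (s : Set (E n))) =
      convexHull ℝ {x | x ∈ s ∧ ∀ y ∈ s, l y ≤ l x} := by
  rw [face_eq_convexHull_inter (s := s) ContinuousLinearMap.toExposed.isExposed]
  congr 1
  ext x
  constructor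
  · rintro ⟨hx, -, h⟩
    exact ⟨hx, fun y hy => h y (subset_convexHull ℝ _ hy)⟩
  · rintro ⟨hx, h⟩
    refine ⟨hx, subset_convexHull ℝ _ hx, fun y hy => ?_⟩
    have : convexHull ℝ (s : Set (E n)) ⊆ {y | l y ≤ l x} :=
      convexHull_min h (convex_halfSpace_le l.toLinearMap.isLinear _)
    exact this hy

theorem mem_vertices_of_forall_lt {s : Finset (E n)} (l : StrongDual ℝ (E n)) {v : E n}
    (hv : v ∈ s) (h : ∀ x ∈ s, x ≠ v → l x < l v) : v ∈ vertices (convexHull ℝ (s : Set (E n))) := by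
  have : l.toExposed (convexHull ℝ (s : Set (E n))) = {v} := by
    rw [toExposed_convexHull]
    have : {x | x ∈ s ∧ ∀ y ∈ s, l y ≤ l x} = {v} := by
      ext x
      constructor
      · rintro ⟨hx, hm⟩
        by_contra hne
        exact absurd (hm v hv) (not_le.2 (h x hx hne))
      · rintro rfl
        exact ⟨hv, fun y hy => by
          by_cases hne : y = x
          · rw [hne]
          · exact (h y hy hne).le⟩
    rw [this, convexHull_singleton]
  rw [vertices, Set.mem_ofPred_eq, ← this]
  exact ContinuousLinearMap.toExposed.isExposed

/-- An extreme point lies outside the compact convex hull of the other generators. A functional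
separating it strictly from that hull exposes it. -/
theorem vertices_eq_extremePoints {P : Set (E n)}
    (hP : ∃ s : Finset (E n), P = convexHull ℝ (s : Set (E n))) :
    vertices P = P.extremePoints ℝ := by
  classical
  obtain ⟨s, rfl⟩ := hP
  ext v
  refine ⟨fun h => exposedPoints_subset_extremePoints
    (mem_exposedPoints_iff_exposed_singleton.2 h), fun h => ?_⟩
  have hvs : v ∈ s := extremePoints_convexHull_subset h
  have hnot : v ∉ convexHull ℝ ((s.erase v : Finset (E n)) : Set (E n)) := by
    intro hmem
    have h2 := (Convex.mem_extremePoints_iff_mem_sdiff_convexHull_sdiff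
      (convex_convexHull ℝ (s : Set (E n)))).1 h
    refine h2.2 (convexHull_mono ?_ hmem)
    intro x hx
    rw [Finset.coe_erase] at hx
    exact ⟨subset_convexHull ℝ _ hx.1, hx.2⟩
  obtain ⟨l, u, h1, h2⟩ := geometric_hahn_banach_closed_point (convex_convexHull ℝ _)
    (isCompact_convexHull_finset (s.erase v)).isClosed hnot
  refine mem_vertices_of_forall_lt l hvs fun x hx hne => (h1 x (subset_convexHull ℝ _ ?_)).trans h2
  simp [hx, hne]

theorem vertices_subset {P : Set (E n)} : vertices P ⊆ P := fun _ hv => hv.subset rfl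

theorem vertices_convexHull_subset (s : Finset (E n)) :
    vertices (convexHull ℝ (s : Set (E n))) ⊆ s := by
  rw [vertices_eq_extremePoints ⟨s, rfl⟩]
  exact extremePoints_convexHull_subset

theorem exists_vertex_mem_face {P F : Set (E n)}
    (hP : ∃ s : Finset (E n), P = convexHull ℝ (s : Set (E n))) (hF : IsExposed ℝ P F)
    (hne : F.Nonempty) : ∃ v ∈ vertices P, v ∈ F := by
  rw [vertices_eq_extremePoints hP]
  obtain ⟨s, rfl⟩ := hP
  obtain ⟨v, hv⟩ := (hF.isCompact (isCompact_convexHull_finset s)).extremePoints_nonempty hne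
  exact ⟨v, hF.isExtreme.extremePoints_subset_extremePoints hv, hv.1⟩

theorem exists_finset_vertices {P : Set (E n)}
    (hP : ∃ s : Finset (E n), P = convexHull ℝ (s : Set (E n))) :
    ∃ s : Finset (E n), (s : Set (E n)) = vertices P ∧ P = convexHull ℝ (s : Set (E n)) := by
  have hv := vertices_eq_extremePoints hP
  obtain ⟨s, rfl⟩ := hP
  have hfin : (vertices (convexHull ℝ (s : Set (E n)))).Finite :=
    s.finite_toSet.subset (vertices_convexHull_subset s)
  refine ⟨hfin.toFinset, hfin.coe_toFinset, ?_⟩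
  rw [hfin.coe_toFinset]
  have h := closure_convexHull_extremePoints (isCompact_convexHull_finset s)
    (convex_convexHull ℝ _)
  rw [← hv, (hfin.isClosed_convexHull ℝ).closure_eq] at h
  exact h.symm

/-- A face of a polytope is the convex hull of the vertices that it contains. -/
theorem face_eq_convexHull_vertices {P F : Set (E n)}
    (hP : ∃ s : Finset (E n), P = convexHull ℝ (s : Set (E n))) (hF : IsExposed ℝ P F) :
    F = convexHull ℝ (vertices P ∩ F) := by
  obtain ⟨s, hs, hPs⟩ := exists_finset_vertices hP
  rw [← hs]
  rw [hPs] at hF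
  exact face_eq_convexHull_inter hF

/-- An isomorphism of face lattices carries vertices to vertices. -/
theorem exists_vertex_map {P : Set (E n)} {Q : Set (E m)}
    (hQ : ∃ s : Finset (E m), Q = convexHull ℝ (s : Set (E m))) (f : Face P ≃o Face Q)
    {v : E n} (hv : v ∈ vertices P) :
    ∃ w ∈ vertices Q, (f ⟨{v}, hv⟩ : Face Q).1 = {w} := by
  have hne : ((f ⟨{v}, hv⟩ : Face Q).1).Nonempty := by
    by_contra hcon
    rw [Set.not_nonempty_iff_eq_empty] at hcon
    have hle : f ⟨{v}, hv⟩ ≤ f ⟨∅, isExposed_empty⟩ := by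
      change (f ⟨{v}, hv⟩).1 ⊆ _
      rw [hcon]
      exact Set.empty_subset _
    have h2 : ({v} : Set (E n)) ⊆ ∅ := f.le_iff_le.1 hle
    exact h2 rfl
  obtain ⟨w, hw, hwF⟩ := exists_vertex_mem_face hQ (f ⟨{v}, hv⟩).2 hne
  refine ⟨w, hw, ?_⟩
  -- Vertices are the atoms of the face lattice: a vertex `w` of the image face pulls back to a
  -- nonempty face inside `{v}`, that is, to `{v}`.
  set W : Face Q := ⟨{w}, hw⟩
  have hle : f.symm W ≤ ⟨{v}, hv⟩ := by
    rw [f.symm_apply_le]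
    exact Set.singleton_subset_iff.2 hwF
  have hsub : (f.symm W).1 ⊆ {v} := hle
  rcases Set.subset_singleton_iff_eq.1 hsub with h | h
  · exfalso
    have h3 : f.symm W ≤ f.symm ⟨∅, isExposed_empty⟩ := by
      change (f.symm W).1 ⊆ _
      rw [h]
      exact Set.empty_subset _
    have h4 : ({w} : Set (E m)) ⊆ ∅ := f.symm.le_iff_le.1 h3
    exact h4 rfl
  · have : f.symm W = ⟨{v}, hv⟩ := Subtype.ext h
    rw [← this, f.apply_symm_apply]

/-- Combinatorially equivalent polytopes have corresponding vertices and faces. -/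
theorem CombEquiv.exists_vertices_equiv {P : Set (E n)} {Q : Set (E m)}
    (hP : ∃ s : Finset (E n), P = convexHull ℝ (s : Set (E n)))
    (hQ : ∃ s : Finset (E m), Q = convexHull ℝ (s : Set (E m))) (h : CombEquiv P Q) :
    ∃ (f : Face P ≃o Face Q) (g : vertices P ≃ vertices Q),
      ∀ (F : Face P) (v : vertices P), (v : E n) ∈ F.1 ↔ (g v : E m) ∈ (f F).1 := by
  obtain ⟨f⟩ := h
  have h1 : ∀ v : vertices P, ∃ w : vertices Q, (f ⟨{v.1}, v.2⟩ : Face Q).1 = {w.1} := fun v => by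
    obtain ⟨w, hw, h⟩ := exists_vertex_map hQ f v.2
    exact ⟨⟨w, hw⟩, h⟩
  have h2 : ∀ w : vertices Q, ∃ v : vertices P, (f.symm ⟨{w.1}, w.2⟩ : Face P).1 = {v.1} :=
    fun w => by
      obtain ⟨v, hv, h⟩ := exists_vertex_map hP f.symm w.2
      exact ⟨⟨v, hv⟩, h⟩
  choose g hg using h1
  choose k hk using h2
  refine ⟨f, ⟨g, k, fun v => ?_, fun w => ?_⟩, fun F v => ?_⟩
  · have e : f ⟨{v.1}, v.2⟩ = ⟨{(g v).1}, (g v).2⟩ := Subtype.ext (hg v)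
    have := hk (g v)
    rw [← e, f.symm_apply_apply] at this
    exact Subtype.ext (Set.singleton_injective this.symm)
  · have e : f.symm ⟨{w.1}, w.2⟩ = ⟨{(k w).1}, (k w).2⟩ := Subtype.ext (hk w)
    have := hg (k w)
    rw [← e, f.apply_symm_apply] at this
    exact Subtype.ext (Set.singleton_injective this.symm)
  · have e : f ⟨{v.1}, v.2⟩ = ⟨{(g v).1}, (g v).2⟩ := Subtype.ext (hg v)
    have h3 : (⟨{v.1}, v.2⟩ : Face P) ≤ F ↔ (⟨{(g v).1}, (g v).2⟩ : Face Q) ≤ f F := by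
      rw [← e, f.le_iff_le]
    exact Set.singleton_subset_iff.symm.trans (h3.trans Set.singleton_subset_iff)

end Polytopes

/-! ### Faces of the cross polytope and its homothetic copies. -/

section CrossPolytope

/-- The sign `1` or `-1` encoded by a Boolean. -/
def sgn (s : Bool) : ℝ := cond s 1 (-1)

@[simp] theorem sgn_true : sgn true = 1 := rfl
@[simp] theorem sgn_false : sgn false = -1 := rfl

theorem sgn_mul_self (s : Bool) : sgn s * sgn s = 1 := by cases s <;> norm_num

theorem sgn_mul_le (s t : Bool) : sgn s * sgn t ≤ 1 := by cases s <;> cases t <;> norm_num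

theorem sgn_mul_lt {s t : Bool} (h : s ≠ t) : sgn s * sgn t < 0 := by
  cases s <;> cases t <;> simp_all

/-- The point `± c eᵢ`. -/
def axisPoint {n : ℕ} (c : ℝ) (i : Fin n) (s : Bool) : E n := EuclideanSpace.single i (c * sgn s)

/-- The points `± c eᵢ`. -/
def axisPoints (n : ℕ) (c : ℝ) : Finset (E n) :=
  open Classical in Finset.univ.image fun p : Fin n × Bool => axisPoint c p.1 p.2

/-- The cross polytope with vertices `± c eᵢ`. -/
def scaledCross (n : ℕ) (c : ℝ) : Set (E n) := convexHull ℝ (axisPoints n c : Set (E n))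

variable {n : ℕ} {c : ℝ}

theorem mem_axisPoints {x : E n} : x ∈ axisPoints n c ↔ ∃ i s, x = axisPoint c i s := by
  simp [axisPoints, eq_comm]

theorem axisPoint_mem (i : Fin n) (s : Bool) : axisPoint c i s ∈ axisPoints n c :=
  mem_axisPoints.2 ⟨i, s, rfl⟩

theorem axisPoint_mem_scaledCross (i : Fin n) (s : Bool) : axisPoint c i s ∈ scaledCross n c :=
  subset_convexHull ℝ _ (axisPoint_mem i s)

theorem crossPolytope_eq_scaledCross : crossPolytope n = scaledCross n 1 := by
  rw [crossPolytope, scaledCross]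
  congr 1
  ext x
  rw [Finset.mem_coe, mem_axisPoints]
  simp only [Set.mem_ofPred_eq, Bool.exists_bool, axisPoint]
  refine exists_congr fun i => ?_
  have : (EuclideanSpace.single i (1 * sgn false) : E n) = -EuclideanSpace.single i 1 := by
    ext j
    by_cases h : j = i <;> simp [h]
  rw [this, or_comm]
  simp

theorem axisPoint_apply (i j : Fin n) (s : Bool) :
    axisPoint c i s j = if j = i then c * sgn s else 0 := by
  simp [axisPoint]

theorem axisPoint_false (i : Fin n) : axisPoint c i false = -axisPoint c i true := by
  ext j
  by_cases h : j = i <;> simp [axisPoint_apply, h]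

/-- The functional that attains its maximum on `scaledCross n c` exactly at `axisPoint c i s`. -/
def axisForm (i : Fin n) (s : Bool) : StrongDual ℝ (E n) := sgn s • EuclideanSpace.proj i

theorem axisForm_apply (i : Fin n) (s : Bool) (x : E n) : axisForm i s x = sgn s * x i := rfl

theorem axisForm_axisPoint (i j : Fin n) (s t : Bool) :
    axisForm i s (axisPoint c j t) = if i = j then c * (sgn s * sgn t) else 0 := by
  rw [axisForm_apply, axisPoint_apply]
  split_ifs <;> ring

theorem axisForm_axisPoint_self (i : Fin n) (s : Bool) :
    axisForm i s (axisPoint c i s) = c := by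
  rw [axisForm_axisPoint, if_pos rfl, sgn_mul_self, mul_one]

theorem axisForm_axisPoint_le (hc : 0 < c) (i j : Fin n) (s t : Bool) :
    axisForm i s (axisPoint c j t) ≤ c := by
  rw [axisForm_axisPoint]
  split_ifs
  · exact mul_le_of_le_one_right hc.le (sgn_mul_le s t)
  · exact hc.le

theorem axisForm_axisPoint_nonpos (hc : 0 < c) {i j : Fin n} {s t : Bool}
    (h : ¬(j = i ∧ t = s)) : axisForm i s (axisPoint c j t) ≤ 0 := by
  rw [axisForm_axisPoint]
  split_ifs with hij
  · exact mul_nonpos_of_nonneg_of_nonpos hc.le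
      (sgn_mul_lt fun hst => h ⟨hij.symm, hst.symm⟩).le
  · exact le_rfl

theorem axisPoint_injective (hc : 0 < c) {i j : Fin n} {s t : Bool}
    (h : axisPoint c i s = axisPoint c j t) : i = j ∧ s = t := by
  by_contra hne
  have h1 := axisForm_axisPoint_nonpos (s := t) hc hne
  rw [h, axisForm_axisPoint_self] at h1
  exact absurd h1 (not_le.2 hc)

theorem axisPoint_mem_vertices (hc : 0 < c) (i : Fin n) (s : Bool) :
    axisPoint c i s ∈ vertices (scaledCross n c) := by
  refine mem_vertices_of_forall_lt (axisForm i s) (axisPoint_mem i s) ?_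
  intro x hx hne
  obtain ⟨j, t, rfl⟩ := mem_axisPoints.1 hx
  rw [axisForm_axisPoint_self]
  refine lt_of_le_of_lt (axisForm_axisPoint_nonpos hc ?_) hc
  rintro ⟨rfl, rfl⟩
  exact hne rfl

theorem mem_vertices_scaledCross (hc : 0 < c) {x : E n} :
    x ∈ vertices (scaledCross n c) ↔ ∃ i s, x = axisPoint c i s := by
  constructor
  · intro h
    exact mem_axisPoints.1 (vertices_convexHull_subset _ h)
  · rintro ⟨i, s, rfl⟩
    exact axisPoint_mem_vertices hc i s

/-- Two vertices on different axes span a face of the cross polytope. -/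
theorem exists_face_of_ne (hc : 0 < c) {i j : Fin n} (hij : i ≠ j) (s t : Bool) :
    ∃ F : Set (E n), IsExposed ℝ (scaledCross n c) F ∧
      ∀ k r, axisPoint c k r ∈ F ↔ (k = i ∧ r = s) ∨ (k = j ∧ r = t) := by
  have hle : ∀ k r, (axisForm i s + axisForm j t) (axisPoint c k r) ≤ c := by
    intro k r
    rw [add_apply]
    by_cases hk : k = i
    · have : axisForm j t (axisPoint c k r) = 0 := by
        rw [axisForm_axisPoint, if_neg (by rintro rfl; exact hij hk.symm)]
      rw [this, add_zero]
      exact axisForm_axisPoint_le hc _ _ _ _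
    · have : axisForm i s (axisPoint c k r) = 0 := by
        rw [axisForm_axisPoint, if_neg (by rintro rfl; exact hk rfl)]
      rw [this, zero_add]
      exact axisForm_axisPoint_le hc _ _ _ _
  have hi : (axisForm i s + axisForm j t) (axisPoint c i s) = c := by
    rw [add_apply, axisForm_axisPoint_self, axisForm_axisPoint,
      if_neg hij.symm, add_zero]
  have hj : (axisForm i s + axisForm j t) (axisPoint c j t) = c := by
    rw [add_apply, axisForm_axisPoint_self, axisForm_axisPoint,
      if_neg hij, zero_add]
  have hall : scaledCross n c ⊆ {y | (axisForm i s + axisForm j t) y ≤ c} := by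
    refine convexHull_min ?_ (convex_halfSpace_le
      (axisForm i s + axisForm j t).toLinearMap.isLinear _)
    intro y hy
    obtain ⟨k, r, rfl⟩ := mem_axisPoints.1 hy
    exact hle k r
  refine ⟨(axisForm i s + axisForm j t).toExposed (scaledCross n c),
    ContinuousLinearMap.toExposed.isExposed, fun k r => ⟨fun h => ?_, fun h => ?_⟩⟩
  -- At any other vertex both forms are nonpositive, while the maximum of their sum is `c > 0`.
  · by_contra hcon
    push Not at hcon
    have h1 := h.2 _ (axisPoint_mem_scaledCross i s)
    rw [hi, add_apply] at h1
    have h2 := axisForm_axisPoint_nonpos (s := s) (t := r) (i := i) (j := k) hc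
      (fun h => hcon.1 h.1 h.2)
    have h3 := axisForm_axisPoint_nonpos (s := t) (t := r) (i := j) (j := k) hc
      (fun h => hcon.2 h.1 h.2)
    linarith
  · refine ⟨axisPoint_mem_scaledCross k r, fun y hy => (hall hy).trans ?_⟩
    rcases h with ⟨rfl, rfl⟩ | ⟨rfl, rfl⟩
    · exact hi.ge
    · exact hj.ge

/-- A face of the cross polytope that contains two opposite vertices is the whole polytope. -/
theorem face_eq_of_opposite_mem {F : Set (E n)} (hF : IsExposed ℝ (scaledCross n c) F) (j : Fin n)
    (h : ∀ s, axisPoint c j s ∈ F) : F = scaledCross n c := by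
  refine hF.subset.antisymm (convexHull_min ?_ (hF.convex (convex_convexHull ℝ _)))
  obtain ⟨l, rfl⟩ := hF ⟨_, h true⟩
  have h1 := (h true).2
  have h2 := (h false).2 _ (axisPoint_mem_scaledCross j true)
  have h3 := h1 _ (axisPoint_mem_scaledCross j false)
  rw [axisPoint_false, map_neg] at h2 h3
  -- A functional maximal at both of two opposite points has maximum `0`. Central symmetry then
  -- makes it vanish at every vertex.
  have h0 : l (axisPoint c j true) = 0 := by linarith
  have hle : ∀ k r, l (axisPoint c k r) ≤ 0 := fun k r =>
    (h1 _ (axisPoint_mem_scaledCross k r)).trans h0.le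
  have hzero : ∀ k r, l (axisPoint c k r) = 0 := by
    intro k r
    have ht := hle k true
    have hf := hle k false
    rw [axisPoint_false, map_neg] at hf
    cases r
    · rw [axisPoint_false, map_neg]
      linarith
    · linarith
  intro x hx
  obtain ⟨k, r, rfl⟩ := mem_axisPoints.1 hx
  refine ⟨axisPoint_mem_scaledCross k r, fun y hy => ?_⟩
  rw [hzero, ← h0]
  exact h1 y hy

theorem scaledCross_isPolytope (hn : 0 < n) (hc : 0 < c) : IsPolytope (scaledCross n c) := by
  refine ⟨⟨_, rfl⟩, ?_⟩
  have hmem : ∀ i s, axisPoint c i s ∈ affineSpan ℝ (scaledCross n c) := fun i s =>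
    subset_affineSpan ℝ _ (axisPoint_mem_scaledCross i s)
  have hne : (affineSpan ℝ (scaledCross n c) : Set (E n)).Nonempty := ⟨_, hmem ⟨0, hn⟩ true⟩
  rw [← AffineSubspace.direction_eq_top_iff_of_nonempty hne, eq_top_iff,
    ← (EuclideanSpace.basisFun (Fin n) ℝ).toBasis.span_eq, Submodule.span_le]
  rintro _ ⟨i, rfl⟩
  have h := (affineSpan ℝ (scaledCross n c)).vsub_mem_direction (hmem i true) (hmem i false)
  have h2 := Submodule.smul_mem _ (2 * c)⁻¹ h
  have he : (EuclideanSpace.basisFun (Fin n) ℝ).toBasis i =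
      (2 * c)⁻¹ • (axisPoint c i true -ᵥ axisPoint c i false) := by
    rw [axisPoint_false]
    ext j
    by_cases hj : j = i
    · subst hj
      simp [axisPoint_apply]
      field_simp
      norm_num
    · simp [axisPoint_apply, hj]
  rw [SetLike.mem_coe, he]
  exact h2

theorem smul_scaledCross {a : ℝ} : (a • · : E n → E n) '' scaledCross n c = scaledCross n (a * c) := by
  rw [scaledCross, scaledCross]
  have : (a • · : E n → E n) = (LinearMap.lsmul ℝ (E n) a) := rfl
  rw [this, LinearMap.image_convexHull]
  congr 1
  ext x
  simp only [Set.mem_image, Finset.mem_coe, mem_axisPoints]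
  have key : ∀ (i : Fin n) s, (LinearMap.lsmul ℝ (E n) a) (axisPoint c i s) = axisPoint (a * c) i s := by
    intro i s
    ext j
    by_cases hj : j = i <;> simp [axisPoint_apply, hj, mul_assoc]
  constructor
  · rintro ⟨_, ⟨i, s, rfl⟩, rfl⟩
    exact ⟨i, s, key i s⟩
  · rintro ⟨i, s, rfl⟩
    exact ⟨_, ⟨i, s, rfl⟩, key i s⟩

theorem isExposed_smul_image {a : ℝ} (ha : 0 < a) {P F : Set (E n)} (h : IsExposed ℝ P F) :
    IsExposed ℝ ((a • · : E n → E n) '' P) ((a • · : E n → E n) '' F) := by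
  rintro ⟨_, x, hx, rfl⟩
  obtain ⟨l, rfl⟩ := h ⟨x, hx⟩
  refine ⟨l, ?_⟩
  ext y
  constructor
  · rintro ⟨z, hz, rfl⟩
    refine ⟨⟨z, hz.1, rfl⟩, ?_⟩
    rintro _ ⟨w, hw, rfl⟩
    simpa [ha] using hz.2 w hw
  · rintro ⟨⟨z, hz, rfl⟩, hm⟩
    refine ⟨z, ⟨hz, fun w hw => ?_⟩, rfl⟩
    simpa [ha] using hm _ ⟨w, hw, rfl⟩

theorem combEquiv_scaledCross (hc : 0 < c) : CombEquiv (scaledCross n 1) (scaledCross n c) := by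
  have hinv : ∀ {a b : ℝ}, a * b = 1 → ∀ F : Set (E n),
      (a • · : E n → E n) '' ((b • · : E n → E n) '' F) = F := by
    intro a b hab F
    rw [Set.image_image]
    simp [smul_smul, hab]
  have e1 : (c • · : E n → E n) '' scaledCross n 1 = scaledCross n c := by
    rw [smul_scaledCross, mul_one]
  have e2 : (c⁻¹ • · : E n → E n) '' scaledCross n c = scaledCross n 1 := by
    rw [smul_scaledCross, inv_mul_cancel₀ hc.ne']
  refine ⟨⟨⟨fun F => ⟨(c • · : E n → E n) '' F.1, ?_⟩, fun F => ⟨(c⁻¹ • · : E n → E n) '' F.1, ?_⟩,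
    fun F => Subtype.ext (hinv (inv_mul_cancel₀ hc.ne') _),
    fun F => Subtype.ext (hinv (mul_inv_cancel₀ hc.ne') _)⟩, ?_⟩⟩
  · rw [← e1]
    exact isExposed_smul_image hc F.2
  · rw [← e2]
    exact isExposed_smul_image (inv_pos.2 hc) F.2
  · intro F G
    exact Set.image_subset_image_iff (smul_right_injective (E n) hc.ne')

end CrossPolytope
-- Edge-scribed realizations: existence, and the metric consequences of tangency.
section Realizations

variable {n : ℕ}

theorem finrank_vectorSpan_of_subset_point {e : Set (E n)} {v : E n} (h : e ⊆ {v}) :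
    Module.finrank ℝ (vectorSpan ℝ e) = 0 := by
  have : vectorSpan ℝ e = ⊥ := by
    rw [eq_bot_iff, ← vectorSpan_singleton ℝ v]
    exact vectorSpan_mono ℝ h
  rw [this, finrank_bot]

/-- The cross polytope with vertices `± √2 eᵢ` is edge-scribed. -/
theorem isEdgeScribed_scaledCross_sqrt_two (hn : 2 ≤ n) : IsEdgeScribed (scaledCross n (√2)) := by
  have hc : (0 : ℝ) < √2 := by positivity
  rintro e ⟨he, hdim⟩
  have hspan := face_eq_convexHull_vertices ⟨_, rfl⟩ he
  have hconv : Convex ℝ e := he.convex (convex_convexHull ℝ _)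
  have hne : e.Nonempty := by
    by_contra hcon
    rw [Set.not_nonempty_iff_eq_empty] at hcon
    rw [hcon, vectorSpan_empty, finrank_bot] at hdim
    exact zero_ne_one hdim
  obtain ⟨v, hv, hve⟩ := exists_vertex_mem_face ⟨_, rfl⟩ he hne
  obtain ⟨w, hw, hwe, hwv⟩ : ∃ w ∈ vertices (scaledCross n (√2)), w ∈ e ∧ w ≠ v := by
    by_contra! hcon
    have : e ⊆ {v} := by
      rw [hspan]
      exact convexHull_min (fun x hx => hcon x hx.1 hx.2) (convex_singleton v)
    rw [finrank_vectorSpan_of_subset_point this] at hdim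
    exact zero_ne_one hdim
  obtain ⟨i, s, rfl⟩ := (mem_vertices_scaledCross hc).1 hv
  obtain ⟨j, t, rfl⟩ := (mem_vertices_scaledCross hc).1 hw
  -- If the two vertices were opposite, the edge would be the whole polytope, of dimension `n ≥ 2`.
  have hij : i ≠ j := by
    rintro rfl
    have hall : ∀ r, axisPoint (√2) i r ∈ e := by
      intro r
      by_cases hr : r = s
      · rw [hr]; exact hve
      · have : r = t := by
          have hts : t ≠ s := fun h => hwv (by rw [h])
          revert hr hts
          cases r <;> cases s <;> cases t <;> simp
        rw [this]; exact hwe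
    have hfull := face_eq_of_opposite_mem he i hall
    rw [hfull, ← direction_affineSpan,
      (scaledCross_isPolytope (by omega) hc).2, AffineSubspace.direction_top, finrank_top,
      finrank_euclideanSpace_fin] at hdim
    omega
  have hinner : ∀ k (r : Bool), ⟪(axisPoint (√2) k r : E n), axisPoint (√2) k r⟫ = 2 := by
    intro k r
    rw [axisPoint, EuclideanSpace.inner_single_left]
    simp only [PiLp.single_apply, if_true, conj_trivial]
    have := sgn_mul_self r
    have h2 := Real.mul_self_sqrt (show (0 : ℝ) ≤ 2 by norm_num)
    calc √2 * sgn r * (√2 * sgn r) = (√2 * √2) * (sgn r * sgn r) := by ring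
      _ = 2 := by rw [this, h2, mul_one]
  have hinner' : ⟪(axisPoint (√2) i s : E n), axisPoint (√2) j t⟫ = 0 := by
    rw [axisPoint, EuclideanSpace.inner_single_left, axisPoint_apply, if_neg hij, mul_zero]
  set v : E n := axisPoint (√2) i s
  set w : E n := axisPoint (√2) j t
  have hwv' : ⟪w, v⟫ = 0 := by rw [real_inner_comm]; exact hinner'
  -- The point of tangency is the midpoint of the edge.
  set p : E n := (1 / 2 : ℝ) • v + (1 / 2 : ℝ) • w with hp
  have hpe : p ∈ e := hconv hve hwe (by norm_num) (by norm_num) (by norm_num)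
  have hperp : ⟪w - v, p⟫ = 0 := by
    rw [hp, inner_sub_left, inner_add_right, inner_add_right]
    simp only [inner_smul_right]
    rw [hinner', hwv', hinner i s, hinner j t]
    ring
  have hnorm : ‖p‖ = 1 := by
    have : ⟪p, p⟫ = 1 := by
      rw [hp]
      simp only [inner_add_left, inner_add_right, inner_smul_left, inner_smul_right, conj_trivial]
      rw [hinner', hwv', hinner i s, hinner j t]
      norm_num
    rw [real_inner_self_eq_norm_sq] at this
    exact (pow_eq_one_iff_of_nonneg (norm_nonneg p) two_ne_zero).1 this
  have hdir : ∀ x ∈ vectorSpan ℝ e, ⟪x, p⟫ = 0 := by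
    intro x hx
    have hmem : w -ᵥ v ∈ vectorSpan ℝ e := vsub_mem_vectorSpan ℝ hwe hve
    obtain ⟨a, ha⟩ := (finrank_eq_one_iff_of_nonzero' (⟨w -ᵥ v, hmem⟩ : vectorSpan ℝ e)
      (by
        intro h
        exact hwv (sub_eq_zero.1 (congrArg Subtype.val h)))).1 hdim ⟨x, hx⟩
    have ha' : a • (w - v) = x := congrArg Subtype.val ha
    rw [← ha', inner_smul_left, hperp, mul_zero]
  refine ⟨p, hpe, ?_, subset_affineSpan ℝ _ hpe, ?_⟩
  · rw [EuclideanGeometry.mem_sphere]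
    simpa [unitSphere] using hnorm
  · intro x hx
    rw [EuclideanGeometry.Sphere.mem_orthRadius_iff_inner_left]
    have := (affineSpan ℝ e).vsub_mem_direction hx (subset_affineSpan ℝ _ hpe)
    rw [direction_affineSpan] at this
    simpa [unitSphere] using hdir _ this

theorem isEdgeScribedRealization_scaledCross (hn : 2 ≤ n) :
    IsEdgeScribedRealization (crossPolytope n) (scaledCross n (√2)) where
  isPolytope := scaledCross_isPolytope (by omega) (by positivity)
  combEquiv := by
    rw [crossPolytope_eq_scaledCross]
    exact combEquiv_scaledCross (by positivity)
  isEdgeScribed := isEdgeScribed_scaledCross_sqrt_two hn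

/-- The vertices of a polytope combinatorially equivalent to the cross polytope, labelled in
opposite pairs. -/
structure IsCrossLabelling (Q : Set (E n)) (v : Fin n → Bool → E n) : Prop where
  mem_vertices_iff : ∀ x, x ∈ vertices Q ↔ ∃ i s, x = v i s
  injective : ∀ i j s t, v i s = v j t → i = j ∧ s = t
  segment : ∀ i j s t, i ≠ j → IsExposed ℝ Q (segment ℝ (v i s) (v j t))
  opposite : ∀ F, IsExposed ℝ Q F → ∀ j, (∀ s, v j s ∈ F) → F = Q

/-- The labels of the standard cross polytope are transported by the face lattice isomorphism, which
preserves incidence. A face with exactly two vertices is their segment. -/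
theorem exists_isCrossLabelling {Q : Set (E n)}
    (hQ : ∃ s : Finset (E n), Q = convexHull ℝ (s : Set (E n)))
    (h : CombEquiv (crossPolytope n) Q) : ∃ v, IsCrossLabelling Q v := by
  rw [crossPolytope_eq_scaledCross] at h
  obtain ⟨f, g, hfg⟩ := CombEquiv.exists_vertices_equiv ⟨_, rfl⟩ hQ h
  have h1 : (0 : ℝ) < 1 := one_pos
  let a : Fin n → Bool → vertices (scaledCross n 1) := fun i s =>
    ⟨axisPoint 1 i s, axisPoint_mem_vertices h1 i s⟩
  have hv : ∀ x, x ∈ vertices Q ↔ ∃ i s, x = (g (a i s) : E n) := by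
    intro x
    constructor
    · intro hx
      obtain ⟨i, s, his⟩ := (mem_vertices_scaledCross h1).1 (g.symm ⟨x, hx⟩).2
      refine ⟨i, s, ?_⟩
      have : a i s = g.symm ⟨x, hx⟩ := Subtype.ext his.symm
      rw [this, g.apply_symm_apply]
    · rintro ⟨i, s, rfl⟩
      exact (g (a i s)).2
  refine ⟨fun i s => g (a i s), hv, ?_, ?_, ?_⟩
  · intro i j s t hij
    have := g.injective (Subtype.ext hij)
    exact axisPoint_injective h1 (congrArg Subtype.val this)
  · intro i j s t hij
    obtain ⟨F, hF, hmem⟩ := exists_face_of_ne h1 hij s t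
    have hG := (f ⟨F, hF⟩).2
    have hmem' : vertices Q ∩ (f ⟨F, hF⟩).1 = {(g (a i s) : E n), (g (a j t) : E n)} := by
      ext x
      constructor
      · rintro ⟨hx, hxF⟩
        obtain ⟨k, r, rfl⟩ := (hv x).1 hx
        rw [← hfg ⟨F, hF⟩ (a k r)] at hxF
        rcases (hmem k r).1 hxF with ⟨rfl, rfl⟩ | ⟨rfl, rfl⟩
        · exact Or.inl rfl
        · exact Or.inr rfl
      · rintro (rfl | rfl)
        · exact ⟨(g _).2, (hfg ⟨F, hF⟩ (a i s)).1 ((hmem i s).2 (Or.inl ⟨rfl, rfl⟩))⟩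
        · exact ⟨(g _).2, (hfg ⟨F, hF⟩ (a j t)).1 ((hmem j t).2 (Or.inr ⟨rfl, rfl⟩))⟩
    rw [← convexHull_pair, ← hmem', ← face_eq_convexHull_vertices hQ hG]
    exact hG
  · intro F hF j hj
    have hpre : (f.symm ⟨F, hF⟩).1 = scaledCross n 1 := by
      refine face_eq_of_opposite_mem (f.symm ⟨F, hF⟩).2 j fun s => ?_
      have := (hfg (f.symm ⟨F, hF⟩) (a j s)).2
      rw [f.apply_symm_apply] at this
      exact this (hj s)
    have htop : (⟨Q, IsExposed.refl Q⟩ : Face Q) ≤ ⟨F, hF⟩ := by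
      rw [← f.symm.le_iff_le]
      change _ ⊆ (f.symm ⟨F, hF⟩).1
      rw [hpre]
      exact (f.symm ⟨Q, IsExposed.refl Q⟩).2.subset
    exact hF.subset.antisymm htop

/-- A segment with a point of the unit sphere at which its line is tangent. -/
theorem inner_of_tangent_segment {v w : E n} {e : Set (E n)} (hv : v ∈ e) (hw : w ∈ e)
    {p : E n} (hp : p ∈ segment ℝ v w)
    (ht : (unitSphere n).IsTangentAt p (affineSpan ℝ e)) :
    1 ≤ ‖v‖ ∧ (‖v‖ = 1 → ⟪v, w⟫ = 1) ∧
      (1 < ‖v‖ → 1 < ‖w‖ → ⟪v, w⟫ - 1 = -(√(‖v‖ ^ 2 - 1) * √(‖w‖ ^ 2 - 1))) := by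
  have hvp := ht.inner_left_eq_zero_of_mem (subset_affineSpan ℝ _ hv)
  have hwp := ht.inner_left_eq_zero_of_mem (subset_affineSpan ℝ _ hw)
  have hp1 : ‖p‖ = 1 := by
    simpa [unitSphere] using EuclideanGeometry.mem_sphere.1 ht.mem_sphere
  have hvp' : ⟪v, p⟫ = 1 := by
    simpa [unitSphere, inner_sub_left, hp1, sub_eq_zero] using hvp
  have hwp' : ⟪w, p⟫ = 1 := by
    simpa [unitSphere, inner_sub_left, hp1, sub_eq_zero] using hwp
  obtain ⟨α, β, hα, hβ, hαβ, rfl⟩ := hp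
  simp only [inner_add_right, inner_smul_right, real_inner_self_eq_norm_sq] at hvp' hwp'
  rw [real_inner_comm] at hwp'
  set C := ⟪v, w⟫ - 1 with hC
  set A := ‖v‖ ^ 2 - 1 with hA
  set B := ‖w‖ ^ 2 - 1 with hB
  -- Both endpoints satisfy `⟪·, p⟫ = 1`. With `p = α v + β w` this is a linear system in `(α, β)`
  -- with matrix `(A, C; C, B)`; having a nonzero solution, it is singular, so `C² = AB`.
  have e1 : α * A = -(β * C) := by rw [hA, hC]; linear_combination hvp' - hαβ
  have e2 : α * C = -(β * B) := by rw [hB, hC]; linear_combination hwp' - hαβ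
  have hv1 : 1 ≤ ‖v‖ := by
    have h := real_inner_le_norm v (α • v + β • w)
    rw [hp1, mul_one] at h
    refine le_trans (le_of_eq ?_) h
    simp only [inner_add_right, inner_smul_right, real_inner_self_eq_norm_sq]
    exact hvp'.symm
  refine ⟨hv1, fun hv1' => ?_, fun hv hw => ?_⟩
  · have hA0 : A = 0 := by rw [hA, hv1']; norm_num
    rw [hA0, mul_zero] at e1
    have hC0 : C = 0 := by
      rcases mul_eq_zero.1 (neg_eq_zero.1 e1.symm) with h | h
      · rw [h] at e2 hαβ
        have : α = 1 := by linarith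
        rw [this] at e2
        linarith
      · exact h
    linarith
  · have hApos : 0 < A := by rw [hA]; nlinarith
    have hBpos : 0 < B := by rw [hB]; nlinarith
    have hα0 : 0 < α := by
      rcases hα.lt_or_eq with h | h
      · exact h
      · exfalso
        rw [← h] at e2 hαβ
        have : β = 1 := by linarith
        rw [this] at e2
        linarith
    have hβ0 : 0 < β := by
      rcases hβ.lt_or_eq with h | h
      · exact h
      · exfalso
        rw [← h] at e1 hαβ
        have : α = 1 := by linarith
        rw [this] at e1
        linarith
    -- The negative root is selected because the point of tangency lies between `v` and `w`.
    have hCneg : C < 0 := by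
      have := mul_pos hα0 hApos
      by_contra hcon
      have := mul_nonneg hβ0.le (not_lt.1 hcon)
      linarith
    have hsq : C * C = A * B := by
      have : (α * β) * (C * C) = (α * β) * (A * B) := by
        linear_combination α * C * e1 - α * A * e2
      exact mul_left_cancel₀ (mul_pos hα0 hβ0).ne' this
    rw [← Real.sqrt_mul hApos.le, ← hsq, Real.sqrt_mul_self_eq_abs, abs_of_neg hCneg, neg_neg]

theorem mem_edges_segment {Q : Set (E n)} {v w : E n} (h : IsExposed ℝ Q (segment ℝ v w))
    (hne : v ≠ w) : segment ℝ v w ∈ edges Q := by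
  refine ⟨h, ?_⟩
  rw [← convexHull_pair, ← direction_affineSpan, affineSpan_convexHull, direction_affineSpan,
    vectorSpan_pair, vsub_eq_sub]
  exact finrank_span_singleton (sub_ne_zero.2 hne)

theorem eq_zero_of_forall_eq_of_affineSpan_eq_top {Q : Set (E n)} (hQ : affineSpan ℝ Q = ⊤)
    (l : E n →ₗ[ℝ] ℝ) {a : ℝ} (h : ∀ x ∈ Q, l x = a) : a = 0 ∧ l = 0 := by
  have hall : ∀ x, l x = a := by
    have hle : affineSpan ℝ Q ≤ (AffineSubspace.mk' a (⊥ : Submodule ℝ ℝ)).comap l.toAffineMap := by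
      refine affineSpan_le.2 fun x hx => ?_
      simp [h x hx]
    intro x
    have := hle (hQ ▸ AffineSubspace.mem_top ℝ (E n) x)
    simpa [sub_eq_zero] using this
  have h0 : a = 0 := by rw [← hall 0, map_zero]
  exact ⟨h0, LinearMap.ext fun x => by rw [hall x, h0]; rfl⟩

/-- If a vertex were on the sphere, it and all its neighbours would lie in the tangent hyperplane
there. Only the opposite vertex could be off it, so the hyperplane would support `Q` in a face
containing another opposite pair. That face is `Q`, against full dimension. -/
theorem IsCrossLabelling.one_lt_norm (hn : 3 ≤ n) {Q : Set (E n)} {v : Fin n → Bool → E n}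
    (hv : IsCrossLabelling Q v) (hQ : IsPolytope Q) (he : IsEdgeScribed Q) (i : Fin n) (s : Bool) :
    1 < ‖v i s‖ := by
  have htan : ∀ j t, i ≠ j → 1 ≤ ‖v i s‖ ∧ (‖v i s‖ = 1 → ⟪v i s, v j t⟫ = 1) := by
    intro j t hij
    obtain ⟨p, hp, ht⟩ := he _ (mem_edges_segment (hv.segment i j s t hij)
      fun h => hij (hv.injective _ _ _ _ h).1)
    have := inner_of_tangent_segment (left_mem_segment ℝ _ _) (right_mem_segment ℝ _ _) hp ht
    exact ⟨this.1, this.2.1⟩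
  obtain ⟨j, hij⟩ : ∃ j, i ≠ j := by
    have : Nontrivial (Fin n) := Fin.nontrivial_iff_two_le.2 (by omega)
    exact exists_ne i |>.imp fun _ h => h.symm
  refine lt_of_le_of_ne (htan j true hij).1 fun h1 => ?_
  have h1 := h1.symm
  have hQv := face_eq_convexHull_vertices hQ.1 (IsExposed.refl Q)
  have hin : ∀ k r, v k r ∈ Q := fun k r => vertices_subset ((hv.mem_vertices_iff _).2 ⟨k, r, rfl⟩)
  have hself : ⟪v i s, v i s⟫ = 1 := by rw [real_inner_self_eq_norm_sq, h1]; norm_num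
  -- The sign `ε` records on which side of the tangent hyperplane the opposite vertex lies.
  obtain ⟨ε, hε, hle⟩ : ∃ ε : ℝ, ε ≠ 0 ∧ ∀ k r, ε * ⟪v i s, v k r⟫ ≤ ε := by
    rcases le_total ⟪v i s, v i (!s)⟫ 1 with h | h
    · refine ⟨1, one_ne_zero, fun k r => ?_⟩
      rw [one_mul]
      by_cases hk : i = k
      · subst hk
        by_cases hr : r = s
        · rw [hr, hself]
        · rw [Bool.eq_not_of_ne hr]; exact h
      · exact ((htan k r hk).2 h1).le
    · refine ⟨-1, by norm_num, fun k r => ?_⟩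
      by_cases hk : i = k
      · subst hk
        by_cases hr : r = s
        · rw [hr, hself, mul_one]
        · rw [Bool.eq_not_of_ne hr]; linarith
      · rw [(htan k r hk).2 h1, mul_one]
  have hQle : ∀ x ∈ Q, (ε • innerSL ℝ (v i s)) x ≤ ε := by
    intro x hx
    rw [hQv] at hx
    refine convexHull_min ?_ (convex_halfSpace_le
      (ε • innerSL ℝ (v i s)).toLinearMap.isLinear ε) hx
    rintro y ⟨hy, -⟩
    obtain ⟨k, r, rfl⟩ := (hv.mem_vertices_iff y).1 hy
    exact hle k r
  have hface : (ε • innerSL ℝ (v i s)).toExposed Q = Q := by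
    refine hv.opposite _ ContinuousLinearMap.toExposed.isExposed j fun t => ⟨hin j t, fun y hy => ?_⟩
    refine (hQle y hy).trans (le_of_eq ?_)
    change ε = ε * ⟪v i s, v j t⟫
    rw [(htan j t hij).2 h1, mul_one]
  have hconst : ∀ x ∈ Q, (ε • innerSL ℝ (v i s)).toLinearMap x = ε := by
    intro x hx
    refine le_antisymm (hQle x hx) ?_
    rw [← hface] at hx
    refine le_trans (le_of_eq ?_) (hx.2 (v j true) (hin j true))
    change ε = ε * ⟪v i s, v j true⟫
    rw [(htan j true hij).2 h1, mul_one]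
  exact hε (eq_zero_of_forall_eq_of_affineSpan_eq_top hQ.2 _ hconst).1

theorem IsCrossLabelling.inner_eq (hn : 3 ≤ n) {Q : Set (E n)} {v : Fin n → Bool → E n}
    (hv : IsCrossLabelling Q v) (hQ : IsPolytope Q) (he : IsEdgeScribed Q) {i j : Fin n}
    (hij : i ≠ j) (s t : Bool) :
    ⟪v i s, v j t⟫ - 1 = -(√(‖v i s‖ ^ 2 - 1) * √(‖v j t‖ ^ 2 - 1)) := by
  obtain ⟨p, hp, ht⟩ := he _ (mem_edges_segment (hv.segment i j s t hij)
    fun h => hij (hv.injective _ _ _ _ h).1)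
  exact (inner_of_tangent_segment (left_mem_segment ℝ _ _) (right_mem_segment ℝ _ _) hp ht).2.2
    (hv.one_lt_norm hn hQ he i s) (hv.one_lt_norm hn hQ he j t)

/-- This is nondegeneracy: no nonzero vector `(a, t)` is Lorentz-orthogonal to all `(v i s, 1)`. -/
theorem IsCrossLabelling.eq_zero_of_forall_inner_eq {Q : Set (E n)} {v : Fin n → Bool → E n}
    (hv : IsCrossLabelling Q v) (hQ : IsPolytope Q) {a : E n} {t : ℝ}
    (h : ∀ i s, ⟪a, v i s⟫ = t) : a = 0 ∧ t = 0 := by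
  have hQv := face_eq_convexHull_vertices hQ.1 (IsExposed.refl Q)
  have hconst : ∀ x ∈ Q, (innerSL ℝ a).toLinearMap x = t := by
    intro x hx
    rw [hQv] at hx
    refine convexHull_min ?_ (convex_hyperplane
      (innerSL ℝ a).toLinearMap.isLinear t) hx
    rintro y ⟨hy, -⟩
    obtain ⟨k, r, rfl⟩ := (hv.mem_vertices_iff y).1 hy
    exact h k r
  obtain ⟨h0, hl⟩ := eq_zero_of_forall_eq_of_affineSpan_eq_top hQ.2 _ hconst
  refine ⟨?_, h0⟩
  have := LinearMap.congr_fun hl a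
  exact (inner_self_eq_zero (𝕜 := ℝ)).1 this

end Realizations
-- Lorentzian linear algebra and the Gram matrix of the vertices.
section Lorentz

variable {n : ℕ}

/-- The Lorentzian form on `𝔼ⁿ × ℝ`. -/
def lorentz (X Y : E n × ℝ) : ℝ := ⟪X.1, Y.1⟫ - X.2 * Y.2

theorem lorentz_comm (X Y : E n × ℝ) : lorentz X Y = lorentz Y X := by
  rw [lorentz, lorentz, real_inner_comm, mul_comm]

theorem lorentz_add_left (X Y Z : E n × ℝ) : lorentz (X + Y) Z = lorentz X Z + lorentz Y Z := by
  simp only [lorentz, Prod.fst_add, Prod.snd_add, inner_add_left]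
  ring

theorem lorentz_sub_left (X Y Z : E n × ℝ) : lorentz (X - Y) Z = lorentz X Z - lorentz Y Z := by
  simp only [lorentz, Prod.fst_sub, Prod.snd_sub, inner_sub_left]
  ring

theorem lorentz_smul_left (a : ℝ) (X Z : E n × ℝ) : lorentz (a • X) Z = a * lorentz X Z := by
  simp only [lorentz, Prod.smul_fst, Prod.smul_snd, real_inner_smul_left, smul_eq_mul]
  ring

theorem lorentz_add_right (X Y Z : E n × ℝ) : lorentz X (Y + Z) = lorentz X Y + lorentz X Z := by
  rw [lorentz_comm, lorentz_add_left, lorentz_comm Y, lorentz_comm Z]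

theorem lorentz_sub_right (X Y Z : E n × ℝ) : lorentz X (Y - Z) = lorentz X Y - lorentz X Z := by
  rw [lorentz_comm, lorentz_sub_left, lorentz_comm Y, lorentz_comm Z]

theorem lorentz_smul_right (a : ℝ) (X Z : E n × ℝ) : lorentz X (a • Z) = a * lorentz X Z := by
  rw [lorentz_comm, lorentz_smul_left, lorentz_comm Z]

theorem lorentz_sum_left {ι : Type*} (s : Finset ι) (X : ι → E n × ℝ) (Z : E n × ℝ) :
    lorentz (∑ i ∈ s, X i) Z = ∑ i ∈ s, lorentz (X i) Z := by
  classical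
  induction s using Finset.induction_on with
  | empty => simp [lorentz]
  | insert a s ha ih => rw [Finset.sum_insert ha, Finset.sum_insert ha, lorentz_add_left, ih]

/-- The orthogonal complement of a timelike vector is spacelike. -/
theorem lorentz_self_pos {u w : E n × ℝ} (hu : lorentz u u < 0) (huw : lorentz u w = 0)
    (hw : w ≠ 0) : 0 < lorentz w w := by
  obtain ⟨a, t⟩ := u
  obtain ⟨b, s⟩ := w
  simp only [lorentz, real_inner_self_eq_norm_sq] at hu huw ⊢
  have ht : 0 < t * t := by nlinarith [sq_nonneg ‖a‖]
  have hcs : (t * s) ^ 2 ≤ ‖a‖ ^ 2 * ‖b‖ ^ 2 := by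
    have := abs_real_inner_le_norm a b
    rw [show t * s = ⟪a, b⟫ by linarith, ← mul_pow, ← sq_abs]
    gcongr
  by_cases hb : b = 0
  · exfalso
    subst hb
    rw [inner_zero_right, zero_sub, neg_eq_zero, mul_eq_zero] at huw
    rcases huw with h | h
    · rw [h] at ht; simp at ht
    · exact hw (by rw [h]; rfl)
  · have hb' : 0 < ‖b‖ ^ 2 := by positivity
    nlinarith

/-- The reverse Cauchy–Schwarz inequality. -/
theorem lorentz_neg_of_timelike {u w : E n × ℝ} (hu : lorentz u u < 0) (hw : lorentz w w < 0)
    (hu0 : 0 < u.2) (hw0 : 0 < w.2) : lorentz u w < 0 := by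
  obtain ⟨a, t⟩ := u
  obtain ⟨b, s⟩ := w
  simp only [lorentz, real_inner_self_eq_norm_sq] at hu hw hu0 hw0 ⊢
  have h1 : ‖a‖ < t := by
    refine lt_of_pow_lt_pow_left₀ 2 hu0.le ?_
    nlinarith
  have h2 : ‖b‖ < s := by
    refine lt_of_pow_lt_pow_left₀ 2 hw0.le ?_
    nlinarith
  have h3 := real_inner_le_norm a b
  have h4 : ‖a‖ * ‖b‖ < t * s := mul_lt_mul'' h1 h2 (norm_nonneg _) (norm_nonneg _)
  linarith

/-- The sum `z + z'` is timelike by the reverse Cauchy–Schwarz inequality, and it is orthogonal to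
`z - z'` because the norms agree. -/
theorem lorentz_sub_self_pos {z z' : E n × ℝ} {r : ℝ} (hr : r < 0) (hz : lorentz z z = r)
    (hz' : lorentz z' z' = r) (h0 : 0 < z.2) (h0' : 0 < z'.2) (hne : z ≠ z') :
    0 < lorentz (z - z') (z - z') := by
  have hneg := lorentz_neg_of_timelike (hz ▸ hr) (hz' ▸ hr) h0 h0'
  refine lorentz_self_pos (u := z + z') ?_ ?_ (sub_ne_zero.2 hne)
  · simp only [lorentz_add_left, lorentz_add_right, lorentz_comm z' z, hz, hz']
    linarith
  · simp only [lorentz_add_left, lorentz_sub_right, lorentz_comm z' z, hz, hz']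
    ring

/-- The reflection in the hyperplane orthogonal to the unit vector `M`. -/
def lorentzReflection (M : E n × ℝ) : E n × ℝ →ₗ[ℝ] E n × ℝ where
  toFun X := X - (2 * lorentz X M) • M
  map_add' X Y := by
    rw [lorentz_add_left]
    module
  map_smul' a X := by
    rw [lorentz_smul_left, RingHom.id_apply]
    module

theorem lorentzReflection_apply (M X : E n × ℝ) :
    lorentzReflection M X = X - (2 * lorentz X M) • M := rfl

theorem lorentz_lorentzReflection {M : E n × ℝ} (X Y : E n × ℝ) :
    lorentz (lorentzReflection M X) Y = lorentz X (lorentzReflection M Y) := by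
  simp only [lorentzReflection_apply, lorentz_sub_left, lorentz_sub_right, lorentz_smul_left,
    lorentz_smul_right, lorentz_comm M Y]
  ring

theorem lorentzReflection_isometry {M : E n × ℝ} (hM : lorentz M M = 1) (X Y : E n × ℝ) :
    lorentz (lorentzReflection M X) (lorentzReflection M Y) = lorentz X Y := by
  simp only [lorentzReflection_apply, lorentz_sub_left, lorentz_sub_right, lorentz_smul_left,
    lorentz_smul_right, lorentz_comm M Y, hM]
  ring

/-- The Gram matrix of the normalized vertices of an edge-scribed cross polytope. -/
theorem lorentz_opposite {x : Fin n → Bool → E n × ℝ} (hn : 3 ≤ n)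
    (hself : ∀ i s, lorentz (x i s) (x i s) = 1)
    (hadj : ∀ i j s t, i ≠ j → lorentz (x i s) (x j t) = -1)
    (hne : ∀ i, x i true ≠ x i false)
    (hnondeg : ∀ Y, (∀ i s, lorentz Y (x i s) = 0) → Y = 0) :
    (∀ i, lorentz (x i true) (x i false) = -3) ∧
      ∀ i j, x i true + x i false = x j true + x j false := by
  have hyx : ∀ i j s, i ≠ j → lorentz (x i true - x i false) (x j s) = 0 := by
    intro i j s hij
    rw [lorentz_sub_left, hadj _ _ _ _ hij, hadj _ _ _ _ hij, sub_self]
  have hyy : ∀ i j, i ≠ j →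
      lorentz (x i true - x i false) (x j true - x j false) = 0 := by
    intro i j hij
    rw [lorentz_sub_right, hyx i j _ hij, hyx i j _ hij, sub_zero]
  have hzy : ∀ i j, lorentz (x i true + x i false) (x j true - x j false) = 0 := by
    intro i j
    rw [lorentz_comm, lorentz_add_right]
    by_cases hij : j = i
    · subst hij
      rw [lorentz_sub_left, lorentz_sub_left, hself, hself, lorentz_comm (x j false)]
      ring
    · rw [hyx j i _ hij, hyx j i _ hij, add_zero]
  have hzz : ∀ i j, i ≠ j → lorentz (x i true + x i false) (x j true + x j false) = -4 := by
    intro i j hij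
    simp only [lorentz_add_left, lorentz_add_right, hadj _ _ _ _ hij]
    norm_num
  -- If isotropic, this difference would be orthogonal to its own pair as well, hence to every `x j
  -- s`, hence zero.
  have hy : ∀ i, lorentz (x i true - x i false) (x i true - x i false) ≠ 0 := by
    intro i h0
    refine hne i (sub_eq_zero.1 (hnondeg _ fun j s => ?_))
    by_cases hij : i = j
    · subst hij
      simp only [lorentz_sub_left, lorentz_sub_right, hself, lorentz_comm (x i false) (x i true)]
        at h0
      have : lorentz (x i true) (x i false) = 1 := by linarith
      cases s
      · rw [lorentz_sub_left, hself, this, sub_self]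
      · rw [lorentz_sub_left, hself, lorentz_comm, this, sub_self]
    · exact hyx i j s hij
  have hz : ∀ i j, x i true + x i false = x j true + x j false := by
    intro i j
    by_cases hij : i = j
    · rw [hij]
    -- The third index, available since `n ≥ 3`, will be used to normalize the two sums.
    obtain ⟨k, hki, hkj⟩ : ∃ k, k ≠ i ∧ k ≠ j := by
      have : ({i, j} : Finset (Fin n)).card < (Finset.univ : Finset (Fin n)).card := by
        rw [Finset.card_univ, Fintype.card_fin]
        exact lt_of_le_of_lt Finset.card_le_two (by omega)
      obtain ⟨k, -, hk⟩ := Finset.exists_mem_notMem_of_card_lt_card this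
      simp only [Finset.mem_insert, Finset.mem_singleton, not_or] at hk
      exact ⟨k, hk⟩
    -- The `n` differences and the two sums are `n + 2` vectors in dimension `n + 1`.
    have hdep : ¬LinearIndependent ℝ (Sum.elim (fun k => x k true - x k false)
        (fun b : Bool => cond b (x i true + x i false) (x j true + x j false))) := by
      intro hli
      have := hli.fintype_card_le_finrank
      simp only [Fintype.card_sum, Fintype.card_fin, Fintype.card_bool, Module.finrank_prod,
        finrank_euclideanSpace_fin, Module.finrank_self] at this
      omega
    obtain ⟨g, hg, hg0⟩ := Fintype.not_linearIndependent_iff.1 hdep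
    simp only [Fintype.sum_sum_type, Sum.elim_inl, Sum.elim_inr, Fintype.sum_bool,
      cond_true, cond_false] at hg
    have hpair : ∀ Z, ∑ k, g (Sum.inl k) * lorentz (x k true - x k false) Z +
        (g (Sum.inr true) * lorentz (x i true + x i false) Z +
          g (Sum.inr false) * lorentz (x j true + x j false) Z) = 0 := by
      intro Z
      have := congrArg (lorentz · Z) hg
      simp only [lorentz_add_left _ _ Z, lorentz_sum_left, lorentz_smul_left] at this ⊢
      rw [this]
      simp [lorentz]
    -- Pairing the relation with a difference isolates its coefficient. Pairing with the `k`-th sum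
    -- then shows that the two remaining coefficients add up to zero.
    have hgl : ∀ k, g (Sum.inl k) = 0 := by
      intro k
      have h := hpair (x k true - x k false)
      rw [hzy, hzy, Finset.sum_eq_single k (fun l _ hl => by rw [hyy l k hl, mul_zero])
        (fun h => absurd (Finset.mem_univ k) h), mul_zero, mul_zero, add_zero, add_zero] at h
      exact (mul_eq_zero.1 h).resolve_right (hy k)
    have hsum : g (Sum.inr true) + g (Sum.inr false) = 0 := by
      have h := hpair (x k true + x k false)
      simp only [hgl, zero_mul, Finset.sum_const_zero, zero_add] at h
      rw [hzz i k hki.symm, hzz j k hkj.symm] at h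
      linarith
    simp only [hgl, zero_smul, Finset.sum_const_zero, zero_add] at hg
    have hne0 : g (Sum.inr true) ≠ 0 := by
      intro h0
      obtain ⟨l, hl⟩ := hg0
      rcases l with l | l
      · exact hl (hgl l)
      · cases l
        · exact hl (by linarith)
        · exact hl h0
    have hneg : g (Sum.inr false) = -g (Sum.inr true) := by linarith
    rw [hneg, neg_smul, ← sub_eq_add_neg, ← smul_sub, smul_eq_zero] at hg
    exact sub_eq_zero.1 (hg.resolve_left hne0)
  refine ⟨fun i => ?_, hz⟩
  obtain ⟨j, hij⟩ : ∃ j, i ≠ j := by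
    have : Nontrivial (Fin n) := Fin.nontrivial_iff_two_le.2 (by omega)
    exact exists_ne i |>.imp fun _ h => h.symm
  have h := hzz i j hij
  rw [← hz i j] at h
  simp only [lorentz_add_left, lorentz_add_right, hself, lorentz_comm (x i false) (x i true)] at h
  linarith

end Lorentz

/-! ### Lorentzian reflections as Möbius transformations. -/

section Moebius

variable {d : ℕ}

/-- The point of `𝔼ᵈ⁺¹` with first coordinates `a` and last coordinate `b`. -/
def join (a : E d) (b : ℝ) : E (d + 1) := WithLp.toLp 2 (Fin.snoc (α := fun _ => ℝ) a b)

@[simp] theorem join_castSucc (a : E d) (b : ℝ) (i : Fin d) : join a b i.castSucc = a i := by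
  simp [join]

@[simp] theorem join_last (a : E d) (b : ℝ) : join a b (Fin.last d) = b := by
  simp [join]

theorem exists_eq_join (x : E (d + 1)) : ∃ a b, x = join a b := by
  refine ⟨WithLp.toLp 2 fun i => x i.castSucc, x (Fin.last d), ?_⟩
  ext i
  refine Fin.lastCases ?_ (fun i => ?_) i <;> simp

theorem inner_join (a a' : E d) (b b' : ℝ) : ⟪join a b, join a' b'⟫ = ⟪a, a'⟫ + b * b' := by
  simp only [PiLp.inner_apply, Fin.sum_univ_castSucc, join_castSucc, join_last]
  simp [mul_comm]

theorem join_sub_smul (a a' : E d) (b b' r : ℝ) :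
    join a b - r • join a' b' = join (a - r • a') (b - r * b') := by
  ext i
  refine Fin.lastCases ?_ (fun i => ?_) i <;> simp

theorem smul_join (a : E d) (b r : ℝ) : r • join a b = join (r • a) (r * b) := by
  ext i
  refine Fin.lastCases ?_ (fun i => ?_) i <;> simp

/-- The lightlike vector that represents a point of the extended space. -/
def lightVector (z : ExtE d) : E (d + 1) × ℝ :=
  z.elim (join 0 1, 1) fun y => (join ((2 : ℝ) • y) (‖y‖ ^ 2 - 1), ‖y‖ ^ 2 + 1)

theorem lightVector_infty : lightVector (OnePoint.infty : ExtE d) = (join 0 1, 1) := rfl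

theorem lightVector_coe (y : E d) : lightVector (y : ExtE d) =
    (join ((2 : ℝ) • y) (‖y‖ ^ 2 - 1), ‖y‖ ^ 2 + 1) := rfl

/-- The ball, half-space or complement of a ball of the extended space with normal vector `N`. -/
def lightBall (N : E (d + 1) × ℝ) : Set (ExtE d) := {z | 0 ≤ lorentz (lightVector z) N}

theorem lightBall_smul {a : ℝ} (ha : 0 < a) (N : E (d + 1) × ℝ) :
    lightBall (a • N) = lightBall N := by
  ext z
  simp only [lightBall, Set.mem_ofPred_eq, lorentz_smul_right, mul_nonneg_iff_of_pos_left ha]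

/-- If `⟪x, v⟫ < 1`, the segment leaving `x` towards `v` enters the open ball at once. Otherwise the
whole segment lies in the half-space `1 ≤ ⟪x, ·⟫`, which misses the open ball. -/
theorem illuminated_eq {n : ℕ} (v : E n) : illuminated v = {x | ‖x‖ = 1 ∧ 1 ≤ ⟪x, v⟫} := by
  ext x
  simp only [illuminated, Set.mem_ofPred_eq]
  refine and_congr_right fun hx => ⟨fun h => ?_, fun h y hy => ?_⟩
  · by_contra! hlt
    set k := ‖v - x‖ ^ 2 with hk
    have hk0 : 0 ≤ k := by positivity
    -- The squared norm at parameter `r` is `1 - 2r(1 - ⟪x, v⟫) + r²k`. This `r` gives `rk < 1 - ⟪x,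
    -- v⟫`, which makes it less than `1`, and keeps `r ≤ 1` even when `k` is small.
    set r := (1 - ⟪x, v⟫) / (k + (1 - ⟪x, v⟫)) with hr
    have hpos : 0 < 1 - ⟪x, v⟫ := by linarith
    have hr0 : 0 < r := by positivity
    have hr1 : r ≤ 1 := by
      rw [hr, div_le_one (by positivity)]
      linarith
    have hmem : x + r • (v - x) ∈ segment ℝ v x := by
      refine ⟨r, 1 - r, hr0.le, by linarith, by ring, ?_⟩
      module
    have h1 := h _ hmem
    have h2 : ‖x + r • (v - x)‖ ^ 2 = 1 - 2 * r * (1 - ⟪x, v⟫) + r ^ 2 * k := by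
      rw [norm_add_sq_real, norm_smul, mul_pow, ← hk, inner_smul_right, inner_sub_right,
        real_inner_self_eq_norm_sq, hx, Real.norm_eq_abs, sq_abs]
      ring
    have h3 : r * (k + (1 - ⟪x, v⟫)) = 1 - ⟪x, v⟫ := by
      rw [hr]; field_simp
    have h4 : 1 ≤ ‖x + r • (v - x)‖ ^ 2 := one_le_pow₀ h1
    rw [h2] at h4
    have h5 : r ^ 2 * k ≤ r * (1 - ⟪x, v⟫) := by
      nlinarith [mul_pos hr0 hpos]
    nlinarith [mul_pos hr0 hpos]
  · obtain ⟨α, β, hα, hβ, hαβ, rfl⟩ := hy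
    have h1 := real_inner_le_norm x (α • v + β • x)
    rw [hx, one_mul, inner_add_right, inner_smul_right, inner_smul_right,
      real_inner_self_eq_norm_sq, hx] at h1
    nlinarith

/-- `lightVector` is inverse stereographic projection in homogeneous coordinates, so only a positive
factor is lost. -/
theorem lightVector_stereo {x : E (d + 1)} (hx : ‖x‖ = 1) :
    ∃ r : ℝ, 0 < r ∧ lightVector (stereo d x) = r • (x, (1 : ℝ)) := by
  obtain ⟨a, b, rfl⟩ := exists_eq_join x
  have hab : ‖a‖ ^ 2 + b * b = 1 := by
    rw [← real_inner_self_eq_norm_sq, ← inner_join, real_inner_self_eq_norm_sq, hx, one_pow]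
  rw [stereo, join_last]
  split_ifs with hb
  · refine ⟨1, one_pos, ?_⟩
    subst hb
    have : a = 0 := by
      have : ‖a‖ ^ 2 = 0 := by linarith
      simpa using this
    rw [lightVector_infty, this, one_smul]
  · have hb1 : 0 < 1 - b := by
      have : b ≤ 1 := by nlinarith [sq_nonneg ‖a‖]
      have := lt_of_le_of_ne this hb
      linarith
    have hy : (WithLp.toLp 2 fun i : Fin d => join a b i.castSucc / (1 - b) : E d) =
        (1 - b)⁻¹ • a := by
      ext i
      simp [div_eq_inv_mul]
    refine ⟨2 / (1 - b), by positivity, ?_⟩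
    have hn : ‖(1 - b)⁻¹ • a‖ ^ 2 = (1 + b) / (1 - b) := by
      rw [norm_smul, mul_pow, Real.norm_eq_abs, sq_abs, show ‖a‖ ^ 2 = (1 - b) * (1 + b) by linarith]
      field_simp
    rw [hy, lightVector_coe, hn, Prod.smul_mk, smul_join, smul_smul]
    refine Prod.ext ?_ ?_
    · simp only
      congr 1
      field_simp
      ring
    · simp only [smul_eq_mul]
      field_simp
      ring

theorem exists_stereo_eq (z : ExtE d) : ∃ x : E (d + 1), ‖x‖ = 1 ∧ stereo d x = z := by
  have hnorm : ∀ {a : E d} {b : ℝ}, ‖a‖ ^ 2 + b * b = 1 → ‖join a b‖ = 1 := by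
    intro a b h
    rw [← real_inner_self_eq_norm_sq, ← inner_join, real_inner_self_eq_norm_sq] at h
    exact (pow_eq_one_iff_of_nonneg (norm_nonneg _) two_ne_zero).1 h
  induction z using OnePoint.rec with
  | infty => exact ⟨join 0 1, hnorm (by simp), by simp [stereo]⟩
  | coe y =>
    have hpos : 0 < ‖y‖ ^ 2 + 1 := by positivity
    refine ⟨join ((2 / (‖y‖ ^ 2 + 1)) • y) ((‖y‖ ^ 2 - 1) / (‖y‖ ^ 2 + 1)), hnorm ?_, ?_⟩
    · rw [norm_smul, mul_pow, Real.norm_eq_abs, sq_abs]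
      field_simp
      ring
    · have h1 : 1 - (‖y‖ ^ 2 - 1) / (‖y‖ ^ 2 + 1) = 2 / (‖y‖ ^ 2 + 1) := by
        field_simp
        ring
      have h2 : (‖y‖ ^ 2 - 1) / (‖y‖ ^ 2 + 1) ≠ 1 := by
        intro h
        rw [h, sub_self] at h1
        exact (by positivity : (2 : ℝ) / (‖y‖ ^ 2 + 1) ≠ 0) h1.symm
      rw [stereo, join_last, if_neg h2]
      congr 1
      ext i
      simp only [join_castSucc, h1, PiLp.smul_apply, smul_eq_mul]
      field_simp

/-- The product of `(x, 1)` and `(v, 1)` is `⟪x, v⟫ - 1`, whose sign decides illumination and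
survives positive rescaling. -/
theorem ballOf_eq_lightBall (v : E (d + 1)) : ballOf v = lightBall (v, 1) := by
  have key : ∀ x : E (d + 1), ‖x‖ = 1 → (x ∈ illuminated v ↔ stereo d x ∈ lightBall (v, 1)) := by
    intro x hx
    obtain ⟨r, hr, h⟩ := lightVector_stereo hx
    rw [illuminated_eq, lightBall, Set.mem_ofPred_eq, Set.mem_ofPred_eq, h, lorentz_smul_left,
      mul_nonneg_iff_of_pos_left hr, lorentz]
    simp [hx]
  ext z
  constructor
  · rintro ⟨x, hx, rfl⟩
    exact (key x hx.1).1 hx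
  · intro hz
    obtain ⟨x, hx, rfl⟩ := exists_stereo_eq z
    exact ⟨x, (key x hx).2 hz, rfl⟩

/-- Reflections of the Lorentzian space induce inversions and hyperplane reflections. -/
theorem exists_moebius_lorentzReflection {M : E (d + 1) × ℝ} (hM : lorentz M M = 1) :
    ∃ φ ∈ moebiusGroup d, ∀ z, ∃ r : ℝ, 0 < r ∧
      lightVector (φ z) = r • lorentzReflection M (lightVector z) := by
  obtain ⟨m', c⟩ := M
  obtain ⟨m, b, rfl⟩ := exists_eq_join m'
  rw [lorentz, inner_join, real_inner_self_eq_norm_sq] at hM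
  simp only at hM
  have hrefl : ∀ (a : E d) (s t : ℝ), lorentzReflection (join m b, c) (join a s, t) =
      (join (a - (2 * (⟪a, m⟫ + s * b - t * c)) • m) (s - 2 * (⟪a, m⟫ + s * b - t * c) * b),
        t - 2 * (⟪a, m⟫ + s * b - t * c) * c) := by
    intro a s t
    rw [lorentzReflection_apply, lorentz, inner_join, ← join_sub_smul]
    rfl
  -- The product of `M` with the light vector of `∞` is `b - c`. If it vanishes, the mirror is the
  -- hyperplane `⟪m, y⟫ = b`. Otherwise, with `p = b - c`, completing the square turns the mirror
  -- equation into `‖y + p⁻¹ m‖² = 1 / p²`, a sphere.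
  by_cases hbc : b = c
  · subst hbc
    have hm : ‖m‖ = 1 := by
      have : ‖m‖ ^ 2 = 1 := by linarith
      exact (pow_eq_one_iff_of_nonneg (norm_nonneg _) two_ne_zero).1 this
    refine ⟨hyperplaneReflection m b hm, Subgroup.subset_closure (Or.inr ⟨m, b, hm, rfl⟩),
      fun z => ⟨1, one_pos, ?_⟩⟩
    rw [one_smul]
    induction z using OnePoint.rec with
    | infty =>
      change lightVector OnePoint.infty = _
      rw [lightVector_infty, hrefl]
      simp
    | coe y =>
      change lightVector ((y - (2 * (⟪m, y⟫ - b)) • m : E d) : ExtE d) = _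
      rw [lightVector_coe, lightVector_coe, hrefl]
      have hn : ‖y - (2 * (⟪m, y⟫ - b)) • m‖ ^ 2 = ‖y‖ ^ 2 - 4 * (⟪m, y⟫ - b) * b := by
        rw [norm_sub_sq_real, norm_smul, mul_pow, Real.norm_eq_abs, sq_abs, inner_smul_right, hm,
          real_inner_comm]
        ring
      rw [hn, real_inner_smul_left, real_inner_comm]
      refine Prod.ext ?_ ?_
      · simp only
        congr 1
        · module
        · ring
      · simp only
        ring
  · have hp : b - c ≠ 0 := sub_ne_zero.2 hbc
    set p := b - c with hpdef
    have hR : 0 < 1 / |p| := by positivity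
    refine ⟨sphereInversion (-(p⁻¹ • m)) (1 / |p|) hR, Subgroup.subset_closure
      (Or.inl ⟨_, _, hR, rfl⟩), fun z => ?_⟩
    have hm : ‖m‖ ^ 2 = 1 - p * (b + c) := by rw [hpdef]; linarith
    induction z using OnePoint.rec with
    | infty =>
      refine ⟨1 / p ^ 2, by positivity, ?_⟩
      change lightVector ((-(p⁻¹ • m) : E d) : ExtE d) = _
      rw [lightVector_infty, lightVector_coe, hrefl, Prod.smul_mk, smul_join, norm_neg, norm_smul,
        mul_pow, Real.norm_eq_abs, sq_abs, hm, inner_zero_left]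
      have hc : b = p + c := by rw [hpdef]; ring
      rw [hc]
      refine Prod.ext ?_ ?_
      · simp only
        congr 1
        · match_scalars
          field_simp
          ring
        · field_simp
          ring
      · simp only [smul_eq_mul]
        field_simp
        ring
    | coe y =>
      by_cases hy : y = -(p⁻¹ • m)
      · refine ⟨p ^ 2, by positivity, ?_⟩
        have : sphereInversion (-(p⁻¹ • m)) (1 / |p|) hR (y : ExtE d) = OnePoint.infty := by
          change inversionFun (-(p⁻¹ • m)) (1 / |p|) (y : ExtE d) = _
          simp [inversionFun, hy]
        rw [this, hy, lightVector_infty, lightVector_coe, hrefl, Prod.smul_mk, smul_join, norm_neg,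
          norm_smul, mul_pow, Real.norm_eq_abs, sq_abs, hm, real_inner_smul_left, inner_neg_left,
          real_inner_smul_left, real_inner_self_eq_norm_sq, hm]
        have hc : b = p + c := by rw [hpdef]; ring
        rw [hc]
        refine Prod.ext ?_ ?_
        · simp only
          congr 1
          · symm
            rw [smul_eq_zero]
            right
            match_scalars
            field_simp
            ring
          · field_simp
            ring
        · simp only [smul_eq_mul]
          field_simp
          ring
      -- Here `D = ‖p y + m‖²`, that is, `p²` times the squared distance to the centre. The image
      -- light vector is rescaled by `D⁻¹`.
      · set D := p ^ 2 * ‖y‖ ^ 2 + 2 * p * ⟪y, m⟫ + ‖m‖ ^ 2 with hD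
        have hdist : dist y (-(p⁻¹ • m)) ^ 2 = D / p ^ 2 := by
          rw [dist_eq_norm, sub_neg_eq_add, norm_add_sq_real, norm_smul, mul_pow, Real.norm_eq_abs,
            sq_abs, inner_smul_right, hD]
          field_simp
        have hDpos : 0 < D := by
          have h1 : 0 < dist y (-(p⁻¹ • m)) ^ 2 := by
            have := dist_pos.2 hy
            positivity
          rw [hdist] at h1
          have := mul_pos h1 (by positivity : 0 < p ^ 2)
          rwa [div_mul_cancel₀ _ (by positivity)] at this
        have hinv : sphereInversion (-(p⁻¹ • m)) (1 / |p|) hR (y : ExtE d) =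
            ((D⁻¹ • (y + p⁻¹ • m) - p⁻¹ • m : E d) : ExtE d) := by
          change inversionFun (-(p⁻¹ • m)) (1 / |p|) (y : ExtE d) = _
          simp only [inversionFun, OnePoint.elim_some, if_neg hy]
          congr 1
          rw [EuclideanGeometry.inversion, div_pow, hdist, div_pow, one_pow, sq_abs, vsub_eq_sub,
            vadd_eq_add, sub_neg_eq_add, ← sub_eq_add_neg]
          congr 2
          field_simp
        refine ⟨D⁻¹, by positivity, ?_⟩
        rw [hinv, lightVector_coe, lightVector_coe, hrefl, Prod.smul_mk, smul_join,
          real_inner_smul_left]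
        have hn : ‖D⁻¹ • (y + p⁻¹ • m) - p⁻¹ • m‖ ^ 2 =
            (1 - 2 * (p * ⟪y, m⟫ + ‖m‖ ^ 2) + ‖m‖ ^ 2 * D) / (D * p ^ 2) := by
          rw [norm_sub_sq_real, norm_smul, norm_smul, mul_pow, mul_pow, norm_add_sq_real, norm_smul,
            mul_pow]
          simp only [Real.norm_eq_abs, sq_abs, inner_smul_left, inner_smul_right, inner_add_left,
            conj_trivial, real_inner_self_eq_norm_sq]
          have : ‖y‖ ^ 2 = (D - 2 * p * ⟪y, m⟫ - ‖m‖ ^ 2) / p ^ 2 := by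
            rw [hD]; field_simp; ring
          rw [this]
          field_simp
          ring
        have hc : b = p + c := by rw [hpdef]; ring
        have hy2 : ‖y‖ ^ 2 = (D - 2 * p * ⟪y, m⟫ - ‖m‖ ^ 2) / p ^ 2 := by
          rw [hD]; field_simp; ring
        rw [hn, hy2, hm, hc]
        -- With `‖y‖²` eliminated in favour of `D`, the remaining identities are rational in
        -- independent quantities.
        clear_value D
        refine Prod.ext ?_ ?_
        · simp only
          congr 1
          · match_scalars
            · field_simp
            · field_simp
              ring
          · field_simp
            ring
        · simp only [smul_eq_mul]
          field_simp
          ring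

/-- The isometries of the Lorentzian space that induce a Möbius transformation. -/
def IsMoebiusLinear (T : E (d + 1) × ℝ →ₗ[ℝ] E (d + 1) × ℝ) : Prop :=
  (∀ X Y, lorentz (T X) (T Y) = lorentz X Y) ∧
    ∃ φ ∈ moebiusGroup d, ∀ N, φ '' lightBall N = lightBall (T N)

theorem IsMoebiusLinear.id : IsMoebiusLinear (LinearMap.id : E (d + 1) × ℝ →ₗ[ℝ] _) :=
  ⟨fun _ _ => rfl, 1, one_mem _, fun N => by simp⟩

theorem IsMoebiusLinear.comp {S T : E (d + 1) × ℝ →ₗ[ℝ] E (d + 1) × ℝ} (hS : IsMoebiusLinear S)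
    (hT : IsMoebiusLinear T) : IsMoebiusLinear (S ∘ₗ T) := by
  obtain ⟨hS1, φ, hφ, hS2⟩ := hS
  obtain ⟨hT1, ψ, hψ, hT2⟩ := hT
  refine ⟨fun X Y => (hS1 _ _).trans (hT1 _ _), φ * ψ, mul_mem hφ hψ, fun N => ?_⟩
  rw [Equiv.Perm.coe_mul, Set.image_comp, hT2, hS2]
  rfl

theorem isMoebiusLinear_lorentzReflection {M : E (d + 1) × ℝ} (hM : lorentz M M = 1) :
    IsMoebiusLinear (lorentzReflection M) := by
  refine ⟨lorentzReflection_isometry hM, ?_⟩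
  obtain ⟨φ, hφ, h⟩ := exists_moebius_lorentzReflection hM
  -- An image under `φ⁻¹` is a preimage under `φ`, and the reflection passes to the normal vector
  -- because it is self-adjoint.
  refine ⟨φ⁻¹, inv_mem hφ, fun N => ?_⟩
  ext z
  have h1 : z ∈ (φ⁻¹ : Equiv.Perm (ExtE d)) '' lightBall N ↔ φ z ∈ lightBall N := by
    constructor
    · rintro ⟨w, hw, rfl⟩
      exact (φ.apply_symm_apply w).symm ▸ hw
    · intro hz
      exact ⟨_, hz, φ.symm_apply_apply z⟩
  rw [h1]
  obtain ⟨r, hr, hz⟩ := h z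
  simp only [lightBall, Set.mem_ofPred_eq]
  rw [hz, lorentz_smul_left, mul_nonneg_iff_of_pos_left hr, lorentz_lorentzReflection]

/-- Two vectors of the same norm with a spacelike difference are exchanged by a reflection. -/
theorem exists_isMoebiusLinear_swap {A B : E (d + 1) × ℝ} (hAB : lorentz A A = lorentz B B)
    (hpos : 0 < lorentz (A - B) (A - B)) :
    ∃ T : E (d + 1) × ℝ →ₗ[ℝ] E (d + 1) × ℝ, IsMoebiusLinear T ∧ T A = B ∧
      ∀ X, lorentz X (A - B) = 0 → T X = X := by
  set q := lorentz (A - B) (A - B) with hq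
  have hsq : (√q)⁻¹ * (√q)⁻¹ = q⁻¹ := by
    rw [← mul_inv, Real.mul_self_sqrt hpos.le]
  have hM : lorentz ((√q)⁻¹ • (A - B)) ((√q)⁻¹ • (A - B)) = 1 := by
    rw [lorentz_smul_left, lorentz_smul_right, ← mul_assoc, hsq, ← hq, inv_mul_cancel₀ hpos.ne']
  refine ⟨_, isMoebiusLinear_lorentzReflection hM, ?_, fun X hX => ?_⟩
  -- Equal norms of `A` and `B` make the reflection along `A - B` subtract exactly `A - B` from `A`.
  · have hA : 2 * lorentz A (A - B) = q := by
      rw [hq]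
      simp only [lorentz_sub_left, lorentz_sub_right, lorentz_comm B A]
      linarith
    have : 2 * lorentz A ((√q)⁻¹ • (A - B)) * (√q)⁻¹ = 1 := by
      rw [lorentz_smul_right]
      calc 2 * ((√q)⁻¹ * lorentz A (A - B)) * (√q)⁻¹
          = (√q)⁻¹ * (√q)⁻¹ * (2 * lorentz A (A - B)) := by ring
        _ = 1 := by rw [hA, hsq, inv_mul_cancel₀ hpos.ne']
    rw [lorentzReflection_apply, smul_smul, this, one_smul, sub_sub_cancel]
  · rw [lorentzReflection_apply, lorentz_smul_right, hX, mul_zero, mul_zero, zero_smul, sub_zero]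

/-- Orthogonal frames with equal Gram matrices and future timelike vectors are related by an
isometry that induces a Möbius transformation. -/
theorem exists_isMoebiusLinear_frame {ι : Type*} {z z' : E (d + 1) × ℝ} {y y' : ι → E (d + 1) × ℝ}
    {r : ℝ} (hr : r < 0) (hz : lorentz z z = r) (hz' : lorentz z' z' = r) (h0 : 0 < z.2)
    (h0' : 0 < z'.2) (hzy : ∀ i, lorentz z (y i) = 0) (hzy' : ∀ i, lorentz z' (y' i) = 0)
    (hyy : ∀ i j, lorentz (y i) (y j) = lorentz (y' i) (y' j))
    (hort : ∀ i j, i ≠ j → lorentz (y' i) (y' j) = 0) (s : Finset ι) :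
    ∃ T : E (d + 1) × ℝ →ₗ[ℝ] E (d + 1) × ℝ, IsMoebiusLinear T ∧ T z = z' ∧
      ∀ i ∈ s, T (y i) = y' i := by
  classical
  induction s using Finset.induction_on with
  | empty =>
    by_cases hne : z = z'
    · exact ⟨_, IsMoebiusLinear.id, hne, by simp⟩
    · obtain ⟨T, hT, hTz, -⟩ := exists_isMoebiusLinear_swap (hz.trans hz'.symm)
        (lorentz_sub_self_pos hr hz hz' h0 h0' hne)
      exact ⟨T, hT, hTz, by simp⟩
  | insert a s ha ih =>
    obtain ⟨T, hT, hTz, hTy⟩ := ih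
    by_cases hne : T (y a) = y' a
    · refine ⟨T, hT, hTz, fun i hi => ?_⟩
      rcases Finset.mem_insert.1 hi with rfl | his
      · exact hne
      · exact hTy i his
    -- Orthogonality to the timelike `z'` makes the difference spacelike, so the swap exists, and it
    -- also makes the swap fix `z'`.
    · have hz'T : lorentz z' (T (y a) - y' a) = 0 := by
        rw [lorentz_sub_right, hzy', ← hTz, hT.1, hzy, sub_zero]
      obtain ⟨S, hS, hSa, hSX⟩ := exists_isMoebiusLinear_swap (A := T (y a)) (B := y' a)
        (by rw [hT.1, hyy]) (lorentz_self_pos (hz' ▸ hr) hz'T (sub_ne_zero.2 hne))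
      refine ⟨S ∘ₗ T, hS.comp hT, ?_, fun i hi => ?_⟩
      · rw [LinearMap.comp_apply, hTz, hSX _ hz'T]
      · rw [LinearMap.comp_apply]
        rcases Finset.mem_insert.1 hi with rfl | his
        · exact hSa
        · have hia : i ≠ a := by rintro rfl; exact ha his
          rw [hTy i his]
          -- The frame vectors already placed are orthogonal to both `T (y a)` and `y' a`, so the
          -- new reflection fixes them.
          refine hSX _ ?_
          rw [lorentz_sub_right, hort i a hia, ← hTy i his, hT.1, hyy, hort i a hia, sub_zero]

end Moebius

/-! ### Normalized vertices and their uniqueness up to Möbius transformations. -/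

section Uniqueness

variable {n : ℕ}

/-- The Lorentzian unit vector of a point outside the unit sphere. -/
def unitVector (v : E n) : E n × ℝ := (√(‖v‖ ^ 2 - 1))⁻¹ • (v, (1 : ℝ))

theorem sqrt_norm_sq_sub_one_pos {v : E n} (hv : 1 < ‖v‖) : 0 < √(‖v‖ ^ 2 - 1) :=
  Real.sqrt_pos.2 (by nlinarith)

theorem lorentz_unitVector_self {v : E n} (hv : 1 < ‖v‖) :
    lorentz (unitVector v) (unitVector v) = 1 := by
  have h := sqrt_norm_sq_sub_one_pos hv
  rw [unitVector, lorentz_smul_left, lorentz_smul_right, ← mul_assoc, ← mul_inv,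
    Real.mul_self_sqrt (Real.sqrt_pos.1 h).le, lorentz, real_inner_self_eq_norm_sq, mul_one]
  exact inv_mul_cancel₀ (Real.sqrt_pos.1 h).ne'

theorem ballOf_eq_lightBall_unitVector {d : ℕ} {v : E (d + 1)} (hv : 1 < ‖v‖) :
    ballOf v = lightBall (unitVector v) := by
  rw [ballOf_eq_lightBall, unitVector, lightBall_smul (inv_pos.2 (sqrt_norm_sq_sub_one_pos hv))]

theorem eq_of_unitVector_eq {v w : E n} (hv : 1 < ‖v‖) (h : unitVector v = unitVector w) :
    v = w := by
  have h1 := congrArg Prod.fst h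
  have h2 := congrArg Prod.snd h
  simp only [unitVector, Prod.smul_mk, smul_eq_mul, mul_one] at h1 h2
  rw [← h2] at h1
  exact smul_right_injective _ (inv_pos.2 (sqrt_norm_sq_sub_one_pos hv)).ne' h1

/-- The properties of the normalized vertices of an edge-scribed cross polytope that determine
them up to isometry. -/
structure IsOctahedralFrame (x : Fin n → Bool → E n × ℝ) : Prop where
  self : ∀ i s, lorentz (x i s) (x i s) = 1
  adjacent : ∀ i j s t, i ≠ j → lorentz (x i s) (x j t) = -1
  opposite : ∀ i, lorentz (x i true) (x i false) = -3
  sum_eq : ∀ i j, x i true + x i false = x j true + x j false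
  snd_pos : ∀ i s, 0 < (x i s).2

theorem IsCrossLabelling.isOctahedralFrame (hn : 3 ≤ n) {Q : Set (E n)} {v : Fin n → Bool → E n}
    (hv : IsCrossLabelling Q v) (hQ : IsPolytope Q) (he : IsEdgeScribed Q) :
    IsOctahedralFrame fun i s => unitVector (v i s) := by
  have hnorm := hv.one_lt_norm hn hQ he
  have hself : ∀ i s, lorentz (unitVector (v i s)) (unitVector (v i s)) = 1 := fun i s =>
    lorentz_unitVector_self (hnorm i s)
  have hadj : ∀ i j s t, i ≠ j → lorentz (unitVector (v i s)) (unitVector (v j t)) = -1 := by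
    intro i j s t hij
    have h1 := sqrt_norm_sq_sub_one_pos (hnorm i s)
    have h2 := sqrt_norm_sq_sub_one_pos (hnorm j t)
    rw [unitVector, unitVector, lorentz_smul_left, lorentz_smul_right, lorentz]
    simp only [mul_one]
    rw [hv.inner_eq hn hQ he hij s t]
    field_simp
  have hopp := lorentz_opposite (x := fun i s => unitVector (v i s)) hn hself hadj
    (fun i h => by simpa using (hv.injective _ _ _ _ (eq_of_unitVector_eq (hnorm i true) h)).2)
    (fun Y hY => by
      have : ∀ i s, ⟪Y.1, v i s⟫ = Y.2 := by
        intro i s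
        have h := hY i s
        rw [unitVector, lorentz_smul_right, mul_eq_zero] at h
        have := h.resolve_left (inv_pos.2 (sqrt_norm_sq_sub_one_pos (hnorm i s))).ne'
        rw [lorentz] at this
        simp only [mul_one] at this
        linarith
      obtain ⟨h1, h2⟩ := hv.eq_zero_of_forall_inner_eq hQ this
      exact Prod.ext h1 h2)
  refine ⟨hself, hadj, hopp.1, hopp.2, fun i s => ?_⟩
  simpa [unitVector] using sqrt_norm_sq_sub_one_pos (hnorm i s)

/-- The common sum has norm `-4` and positive last coordinate, and it is orthogonal to the
differences, which are mutually orthogonal of norm `8`. These data match for both frames, and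
half-sums and half-differences recover the vectors themselves. -/
theorem IsOctahedralFrame.exists_isMoebiusLinear {d : ℕ}
    {x x' : Fin (d + 1) → Bool → E (d + 1) × ℝ} (h : IsOctahedralFrame x)
    (h' : IsOctahedralFrame x') :
    ∃ T : E (d + 1) × ℝ →ₗ[ℝ] E (d + 1) × ℝ, IsMoebiusLinear T ∧ ∀ i s, T (x i s) = x' i s := by
  have hzz : ∀ {x : Fin (d + 1) → Bool → E (d + 1) × ℝ}, IsOctahedralFrame x →
      lorentz (x 0 true + x 0 false) (x 0 true + x 0 false) = -4 := by
    intro x h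
    simp only [lorentz_add_left, lorentz_add_right, h.self, lorentz_comm (x 0 false), h.opposite]
    norm_num
  have hzy : ∀ {x : Fin (d + 1) → Bool → E (d + 1) × ℝ}, IsOctahedralFrame x →
      ∀ i, lorentz (x 0 true + x 0 false) (x i true - x i false) = 0 := by
    intro x h i
    rw [h.sum_eq 0 i]
    simp only [lorentz_add_left, lorentz_sub_right, h.self, lorentz_comm (x i false) (x i true)]
    ring
  have hyy : ∀ {x : Fin (d + 1) → Bool → E (d + 1) × ℝ}, IsOctahedralFrame x → ∀ i j,
      lorentz (x i true - x i false) (x j true - x j false) = if i = j then 8 else 0 := by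
    intro x h i j
    split_ifs with hij
    · subst hij
      simp only [lorentz_sub_left, lorentz_sub_right, h.self, lorentz_comm (x i false) (x i true),
        h.opposite]
      norm_num
    · simp only [lorentz_sub_left, lorentz_sub_right, h.adjacent _ _ _ _ hij]
      norm_num
  obtain ⟨T, hT, hTz, hTy⟩ := exists_isMoebiusLinear_frame (r := -4) (by norm_num) (hzz h) (hzz h')
    (add_pos (h.snd_pos 0 true) (h.snd_pos 0 false))
    (add_pos (h'.snd_pos 0 true) (h'.snd_pos 0 false)) (hzy h) (hzy h')
    (fun i j => (hyy h i j).trans (hyy h' i j).symm)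
    (fun i j hij => by rw [hyy h' i j, if_neg hij]) Finset.univ
  refine ⟨T, hT, fun i s => ?_⟩
  have hplus : ∀ x : Fin (d + 1) → Bool → E (d + 1) × ℝ, x i true =
      (1 / 2 : ℝ) • ((x i true + x i false) + (x i true - x i false)) := fun x => by module
  have hminus : ∀ x : Fin (d + 1) → Bool → E (d + 1) × ℝ, x i false =
      (1 / 2 : ℝ) • ((x i true + x i false) - (x i true - x i false)) := fun x => by module
  cases s
  · rw [hminus x, hminus x', h.sum_eq i 0, h'.sum_eq i 0, map_smul, map_sub, hTz,
      hTy i (Finset.mem_univ i)]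
  · rw [hplus x, hplus x', h.sum_eq i 0, h'.sum_eq i 0, map_smul, map_add, hTz,
      hTy i (Finset.mem_univ i)]

theorem IsCrossLabelling.ballArrangement_eq {d : ℕ} (hn : 3 ≤ d + 1) {Q : Set (E (d + 1))}
    {v : Fin (d + 1) → Bool → E (d + 1)} (hv : IsCrossLabelling Q v) (hQ : IsPolytope Q)
    (he : IsEdgeScribed Q) :
    ballArrangement Q = {b | ∃ i s, b = lightBall (unitVector (v i s))} := by
  ext b
  constructor
  · rintro ⟨x, hx, rfl⟩
    obtain ⟨i, s, rfl⟩ := (hv.mem_vertices_iff x).1 hx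
    exact ⟨i, s, ballOf_eq_lightBall_unitVector (hv.one_lt_norm hn hQ he i s)⟩
  · rintro ⟨i, s, rfl⟩
    exact ⟨v i s, (hv.mem_vertices_iff _).2 ⟨i, s, rfl⟩,
      ballOf_eq_lightBall_unitVector (hv.one_lt_norm hn hQ he i s)⟩

end Uniqueness

end BallPacking

end

theorem mainTheorem3 (d : ℕ) (hd : 2 ≤ d) :
    BallPacking.IsMoebiusUnique (BallPacking.crossPolytope (d + 1)) := by
  have hn : 3 ≤ d + 1 := by omega
  refine ⟨⟨_, BallPacking.isEdgeScribedRealization_scaledCross (by omega)⟩, fun Q Q' hQ hQ' => ?_⟩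
  obtain ⟨v, hv⟩ := BallPacking.exists_isCrossLabelling hQ.isPolytope.1 hQ.combEquiv
  obtain ⟨v', hv'⟩ := BallPacking.exists_isCrossLabelling hQ'.isPolytope.1 hQ'.combEquiv
  obtain ⟨T, ⟨-, φ, hφ, hball⟩, hT⟩ :=
    (hv.isOctahedralFrame hn hQ.isPolytope hQ.isEdgeScribed).exists_isMoebiusLinear
      (hv'.isOctahedralFrame hn hQ'.isPolytope hQ'.isEdgeScribed)
  refine ⟨φ, hφ, ?_⟩
  rw [hv.ballArrangement_eq hn hQ.isPolytope hQ.isEdgeScribed,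
    hv'.ballArrangement_eq hn hQ'.isPolytope hQ'.isEdgeScribed]
  ext b
  constructor
  · rintro ⟨_, ⟨i, s, rfl⟩, rfl⟩
    exact ⟨i, s, by simp only [hball, hT]⟩
  · rintro ⟨i, s, rfl⟩
    exact ⟨_, ⟨i, s, rfl⟩, by simp only [hball, hT]⟩
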